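/- Throughout, $\lambda$ is the security parameter, a function is negligible if it is $O(\lambda^{-c})$ for every $c$, and adversaries are non-uniform quantum polynomial-time (QPT) algorithms with quantum advice: for each $\lambda$, a polynomial-size quantum circuit applied to the input and to a polynomial-size advice state, followed by a measurement. $\mathrm{TD}(\rho,\sigma)=\frac12\|\rho-\sigma\|_1$. An EFI pair is a family $\{\xi_{\lambda,b}\}_{\lambda\in\mathbb N,\,b\in\{0,1\}}$ of (mixed) quantum states such that (i) a uniform QPT algorithm generates $\xi_{\lambda,b}$ on input $1^\lambda$ and $b$; (ii) there is a constant $c$ with $\mathrm{TD}(\xi_{\lambda,0},\xi_{\lambda,1})\ge\lambda^{-c}$ for all sufficiently large $\lambda$; (iii) for every adversary $\mathcal B$ with one output bit, the advantage $\mathrm{Adv}_{\mathcal B}(\lambda)=|\Pr[\mathcal B(1^\lambda,\xi_{\lambda,0})=1]-\Pr[\mathcal B(1^\lambda,\xi_{\lambda,1})=1]|$ is bounded by a negligible function. An inefficiently-verifiable one-way state generator (IV-OWSG) is a triple $(\mathsf{KeyGen},\mathsf{StateGen},\mathsf{Ver})$, where $\mathsf{KeyGen}(1^\lambda)\to k\in\{0,1\}^\lambda$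 and $\mathsf{StateGen}(k)\to\phi_k$ (a possibly mixed state) are uniform QPT algorithms and $\mathsf{Ver}(k',\cdot)\to\{\top,\bot\}$ is, for each $k'\in\{0,1\}^\lambda$, an arbitrary, not necessarily efficient, two-outcome measurement, such that * (Correctness) $\Pr[\top\gets\mathsf{Ver}(k,\phi_k): k\gets\mathsf{KeyGen}(1^\lambda),\ \phi_k\gets\mathsf{StateGen}(k)]\ge 1-\mathrm{negl}(\lambda)$ for some negligible function $\mathrm{negl}$; * (Security) for every polynomially bounded $t=t(\lambda)$ and every adversary $\mathcal A$, the success probability $$\mathrm{Succ}_{\mathcal A,t}(\lambda)=\Pr[\top\gets\mathsf{Ver}(k',\phi_k): k\gets\mathsf{KeyGen}(1^\lambda),\ \phi_k\gets\mathsf{StateGen}(k),\ k'\gets\mathcal A(1^\lambda,\phi_k^{\otimes t(\lambda)})]$$ is bounded by a negligible function. **Theorem.** If EFI pairs exist, then IV-OWSGs exist. Moreover, this holds with at most a polynomial loss of security: for every EFI pair there are an IV-OWSG and a constant $C$ such that for every polynomially bounded $t$ there is a polynomial $q$ such that for every adversary $\mathcal A$ against the IV-OWSG that is given $t(\lambda)$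 copies there is an adversary $\mathcal B$ against the EFI pair with $$\mathrm{Succ}_{\mathcal A,t}(\lambda)\le q(\lambda)\cdot\mathrm{Adv}_{\mathcal B}(\lambda)+C\cdot 2^{-\lambda}\qquad\text{for all }\lambda\in\mathbb N.$$ -/

import Mathlib

noncomputable section

open scoped MatrixOrder ComplexOrder

namespace QCrypto

/-! ### Quantum states on labelled qubits

The Hilbert space of a register whose qubits are labelled by a finite type `W` has the
computational basis `W → Bool`; operators are matrices in that basis. -/

/-- Operators on the register with qubit labels `W`. -/
abbrev Op (W : Type) : Type := Matrix (W → Bool) (W → Bool) ℂ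

section States

variable {W V : Type}

/-- A (mixed) quantum state: a density operator. -/
def IsState [Fintype W] [DecidableEq W] (ρ : Op W) : Prop :=
  ρ.PosSemidef ∧ ρ.trace = 1

/-- A POVM element (the accepting effect of a two-outcome measurement): `0 ≤ E ≤ I`. -/
def IsPOVMElement [Fintype W] [DecidableEq W] (E : Op W) : Prop :=
  E.PosSemidef ∧ (1 - E).PosSemidef

/-- The pure state `|0…0⟩⟨0…0|`. -/
def zeroState (W : Type) [Fintype W] [DecidableEq W] : Op W :=
  Matrix.single (fun _ => false) (fun _ => false) 1

/-- The tensor product `ρ ⊗ σ` on the disjoint union of two registers. -/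
def tensor (ρ : Op W) (σ : Op V) : Op (W ⊕ V) :=
  fun x y => ρ (x ∘ Sum.inl) (y ∘ Sum.inl) * σ (x ∘ Sum.inr) (y ∘ Sum.inr)

/-- The tensor power `ρ^{⊗ t}`; the label `(i, w)` is the qubit `w` of the `i`-th copy. -/
def tensorPow (ρ : Op W) (t : ℕ) : Op (Fin t × W) :=
  fun x y => ∏ i, ρ (fun w => x (i, w)) (fun w => y (i, w))

/-- The partial trace over the second register. -/
def partialTrace [Fintype V] [DecidableEq V] (ρ : Op (W ⊕ V)) : Op W :=
  fun x y => ∑ z : V → Bool, ρ (Sum.elim x z) (Sum.elim y z)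

/-- The trace norm `‖A‖₁ = Tr √(A† A)`. -/
def traceNorm [Fintype W] [DecidableEq W] (A : Op W) : ℝ :=
  (CFC.abs A).trace.re

/-- The trace distance `½ ‖ρ - σ‖₁`. -/
def traceDist [Fintype W] [DecidableEq W] (ρ σ : Op W) : ℝ :=
  (1 / 2) * traceNorm (ρ - σ)

/-- The probability `Tr (E ρ)` that the POVM element `E` accepts the state `ρ`. -/
def acceptProb [Fintype W] [DecidableEq W] (E ρ : Op W) : ℝ :=
  (E * ρ).trace.re

/-- The probability of the outcome `z` when the qubits `out 0, out 1, …` of the state `ρ` are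
measured in the computational basis. -/
def outcomeProb [Fintype W] [DecidableEq W] {m : ℕ} (ρ : Op W) (out : Fin m → W)
    (z : Fin m → Bool) : ℝ :=
  ∑ x : W → Bool, if x ∘ out = z then (ρ x x).re else 0

end States

/-! ### Quantum circuits -/

/-- Gates of the universal gate set Hadamard, `T`, controlled-not, Toffoli, on qubits `W`. -/
inductive Gate (W : Type) : Type
  | H (q : W)
  | T (q : W)
  | CNOT (c t : W) (h : c ≠ t)
  | CCNOT (c₁ c₂ t : W) (h : c₁ ≠ c₂) (h₁ : c₁ ≠ t) (h₂ : c₂ ≠ t)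

section Circuits

variable {W : Type} [Fintype W] [DecidableEq W]

/-- The one-qubit operator `U` applied to the qubit `q`, tensored with the identity. -/
def onQubit (U : Matrix Bool Bool ℂ) (q : W) : Op W :=
  fun x y => if ∀ w, w ≠ q → x w = y w then U (x q) (y q) else 0

/-- The operator sending each basis vector `|y⟩` to `|f y⟩`. -/
def onBasis (f : (W → Bool) → (W → Bool)) : Op W :=
  fun x y => if x = f y then 1 else 0

/-- The matrix `2^{-1/2} ((1, 1), (1, -1))`. -/
def hadamardMatrix : Matrix Bool Bool ℂ :=
  fun a b => ((1 / Real.sqrt 2 : ℝ) : ℂ) * (if a && b then -1 else 1)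

/-- The matrix `diag (1, e^{iπ/4})`. -/
def tMatrix : Matrix Bool Bool ℂ :=
  Matrix.diagonal fun b => if b then Complex.exp ((Real.pi / 4 : ℝ) * Complex.I) else 1

/-- The unitary operator of a gate. -/
def Gate.toOp : Gate W → Op W
  | .H q => onQubit hadamardMatrix q
  | .T q => onQubit tMatrix q
  | .CNOT c t _ => onBasis fun y => Function.update y t (xor (y t) (y c))
  | .CCNOT c₁ c₂ t _ _ _ => onBasis fun y => Function.update y t (xor (y t) (y c₁ && y c₂))

/-- The unitary operator of a circuit; the head of the list is the gate that is applied first. -/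
def circuitOp : List (Gate W) → Op W
  | [] => 1
  | g :: C => circuitOp C * g.toOp

/-- The state after running the circuit `C` on the state `ρ`. -/
def runCircuit (C : List (Gate W)) (ρ : Op W) : Op W :=
  circuitOp C * ρ * (circuitOp C).conjTranspose

/-- The state on the `n` output qubits after running a circuit on `|0…0⟩` and tracing out the
`a` ancilla qubits. -/
def preparedState {n a : ℕ} (C : List (Gate (Fin n ⊕ Fin a))) : Op (Fin n) :=
  partialTrace (runCircuit C (zeroState (Fin n ⊕ Fin a)))

end Circuits

/-! ### Description of circuits as bit strings -/

/-- `n` in self-delimiting unary. -/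
def encodeUnary (n : ℕ) : List Bool := List.replicate n true ++ [false]

/-- The address of a qubit: a bit for the register, followed by the index in unary. -/
def encodeWire {n a : ℕ} : Fin n ⊕ Fin a → List Bool
  | .inl i => false :: encodeUnary i
  | .inr j => true :: encodeUnary j

/-- A two-bit opcode followed by the addresses of the qubits on which the gate acts. -/
def encodeGate {n a : ℕ} : Gate (Fin n ⊕ Fin a) → List Bool
  | .H q => false :: false :: encodeWire q
  | .T q => false :: true :: encodeWire q
  | .CNOT c t _ => true :: false :: (encodeWire c ++ encodeWire t)
  | .CCNOT c₁ c₂ t _ _ _ => true :: true :: (encodeWire c₁ ++ encodeWire c₂ ++ encodeWire t)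

/-- The numbers of output and of ancilla qubits, followed by the list of gates. -/
def encodeCircuit {n a : ℕ} (C : List (Gate (Fin n ⊕ Fin a))) : List Bool :=
  encodeUnary n ++ encodeUnary a ++ C.flatMap encodeGate

/-! ### Classical machines with a step count

A deterministic machine with finitely many stacks (a program mentions only finitely many) of
bits, controlled by a structured program. Every elementary step touches only the top of one
stack, so that running times agree with those of multi-tape Turing machines up to polynomials. -/

/-- Contents of the stacks; the head of a list is the top of the stack. -/
abbrev Store : Type := ℕ → List Bool

/-- Programs. -/
inductive Cmd : Type
  | skip
  | push (r : ℕ) (b : Bool)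
  | pop (r : ℕ)
  | seq (p q : Cmd)
  /-- Continue according to whether stack `r` is empty, has top `false`, or has top `true`. -/
  | branch (r : ℕ) (onEmpty onFalse onTrue : Cmd)
  /-- Repeat `p` as long as stack `r` is nonempty. -/
  | loop (r : ℕ) (p : Cmd)

/-- `p.Runs s k s'`: started on `s`, the program `p` halts after exactly `k` steps with `s'`. -/
inductive Cmd.Runs : Cmd → Store → ℕ → Store → Prop
  | skip (s : Store) : Runs .skip s 1 s
  | push (s : Store) (r : ℕ) (b : Bool) :
      Runs (.push r b) s 1 (Function.update s r (b :: s r))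
  | pop (s : Store) (r : ℕ) : Runs (.pop r) s 1 (Function.update s r (s r).tail)
  | seq {p q : Cmd} {s s' s'' : Store} {k k' : ℕ} :
      Runs p s k s' → Runs q s' k' s'' → Runs (.seq p q) s (k + k') s''
  | branchEmpty {r : ℕ} {p₀ p₁ p₂ : Cmd} {s s' : Store} {k : ℕ} :
      s r = [] → Runs p₀ s k s' → Runs (.branch r p₀ p₁ p₂) s (k + 1) s'
  | branchFalse {r : ℕ} {p₀ p₁ p₂ : Cmd} {s s' : Store} {k : ℕ} :
      (s r).head? = some false → Runs p₁ s k s' → Runs (.branch r p₀ p₁ p₂) s (k + 1) s'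
  | branchTrue {r : ℕ} {p₀ p₁ p₂ : Cmd} {s s' : Store} {k : ℕ} :
      (s r).head? = some true → Runs p₂ s k s' → Runs (.branch r p₀ p₁ p₂) s (k + 1) s'
  | loopDone {r : ℕ} {p : Cmd} {s : Store} : s r = [] → Runs (.loop r p) s 1 s
  | loopStep {r : ℕ} {p : Cmd} {s s' s'' : Store} {k k' : ℕ} :
      s r ≠ [] → Runs p s k s' → Runs (.loop r p) s' k' s'' →
      Runs (.loop r p) s (k + k' + 1) s''

/-- The initial store on input `(1^lam, x)`: `1^lam` on stack `0`, `x` on stack `1`. -/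
def initStore (lam : ℕ) (x : List Bool) : Store := fun r =>
  if r = 0 then List.replicate lam true else if r = 1 then x else []

/-! ### Uniform and non-uniform quantum polynomial time -/

/-- A uniform QPT algorithm generates the states `ρ lam x`: on input `(1^lam, x)`, a program
writes on stack `0`, within a number of steps polynomial in `lam`, the description of a quantum
circuit that prepares `ρ lam x` from `|0…0⟩` up to tracing out ancilla qubits. -/
def UniformQPTGenerates (I : ℕ → Type) (enc : ∀ lam, I lam → List Bool) (n : ℕ → ℕ)
    (ρ : ∀ lam, I lam → Op (Fin (n lam))) : Prop :=
  ∃ (P : Cmd) (p : Polynomial ℕ), ∀ (lam : ℕ) (x : I lam),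
    ∃ (a : ℕ) (C : List (Gate (Fin (n lam) ⊕ Fin a))) (k : ℕ) (s : Store),
      P.Runs (initStore lam (enc lam x)) k s ∧ k ≤ p.eval lam ∧
        s 0 = encodeCircuit C ∧ ρ lam x = preparedState C

/-- Boundedness by a polynomial. -/
def PolyBounded (f : ℕ → ℕ) : Prop := ∃ p : Polynomial ℕ, ∀ lam, f lam ≤ p.eval lam

/-- Negligible functions of the security parameter. -/
def Negligible (f : ℕ → ℝ) : Prop :=
  Asymptotics.SuperpolynomialDecay Filter.atTop (fun lam : ℕ => (lam : ℝ)) f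

/-- A non-uniform QPT adversary with quantum advice. For the security parameter `lam` its input
is a state of the register `In lam` and its output is a string of `m lam` bits: a
circuit of polynomial size, which may depend arbitrarily on `lam`, is run on the input and an
advice state of polynomially many qubits, and then `m lam` of the qubits are measured. Ancilla
qubits initialised to `|0⟩` are part of the advice. -/
structure Adversary (In : ℕ → Type) [∀ lam, Fintype (In lam)] [∀ lam, DecidableEq (In lam)]
    (m : ℕ → ℕ) where
  adviceQubits : ℕ → ℕ
  advice : ∀ lam, Op (Fin (adviceQubits lam))
  advice_isState : ∀ lam, IsState (advice lam)
  circuit : ∀ lam, List (Gate (In lam ⊕ Fin (adviceQubits lam)))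
  out : ∀ lam, Fin (m lam) ↪ In lam ⊕ Fin (adviceQubits lam)
  adviceQubits_poly : PolyBounded adviceQubits
  circuit_poly : PolyBounded fun lam => (circuit lam).length

/-- The probability that the adversary outputs `z` on the input state `ρ`. -/
def Adversary.prob {In : ℕ → Type} [∀ lam, Fintype (In lam)] [∀ lam, DecidableEq (In lam)]
    {m : ℕ → ℕ} (A : Adversary In m) (lam : ℕ) (ρ : Op (In lam)) (z : Fin (m lam) → Bool) : ℝ :=
  outcomeProb (runCircuit (A.circuit lam) (tensor ρ (A.advice lam))) (A.out lam) z

/-! ### EFI pairs -/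

/-- A family of pairs of operators `ξ lam b` on `n lam` qubits. -/
structure StatePair where
  n : ℕ → ℕ
  ξ : ∀ lam, Bool → Op (Fin (n lam))

/-- Non-uniform QPT distinguishers: one output bit. -/
abbrev StatePair.Distinguisher (S : StatePair) : Type :=
  Adversary (fun lam => Fin (S.n lam)) (fun _ => 1)

/-- `|Pr[B(1^lam, ξ_{lam,0}) = 1] - Pr[B(1^lam, ξ_{lam,1}) = 1]|`. -/
def StatePair.advantage (S : StatePair) (B : S.Distinguisher) (lam : ℕ) : ℝ :=
  |B.prob lam (S.ξ lam false) (fun _ => true) - B.prob lam (S.ξ lam true) (fun _ => true)|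

/-- EFI pairs: efficiently generatable, statistically far, computationally indistinguishable. -/
structure StatePair.IsEFI (S : StatePair) : Prop where
  generatable : UniformQPTGenerates (fun _ => Bool) (fun _ b => [b]) S.n S.ξ
  far : ∃ c : ℕ, ∀ᶠ lam : ℕ in Filter.atTop,
    1 / (lam : ℝ) ^ c ≤ traceDist (S.ξ lam false) (S.ξ lam true)
  indistinguishable : ∀ B : S.Distinguisher, ∃ ν : ℕ → ℝ, Negligible ν ∧
    ∀ lam, S.advantage B lam ≤ ν lam

/-! ### One-way state generators with inefficient verification -/

/-- Keys: bit strings of length `lam`. -/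
abbrev Key (lam : ℕ) : Type := Fin lam → Bool

/-- The data of a one-way state generator. -/
structure StateGenerator where
  /-- Output state of `KeyGen(1^lam)`; the key is obtained by measuring it in the
  computational basis. -/
  keyState : ∀ lam, Op (Fin lam)
  /-- Number of qubits of the states `φ_k`, for keys `k` of length `lam`. -/
  n : ℕ → ℕ
  /-- The state `φ_k` output by `StateGen(k)`. -/
  φ : ∀ lam, Key lam → Op (Fin (n lam))
  /-- The POVM element with which `Ver(k', ·)` accepts. -/
  ver : ∀ lam, Key lam → Op (Fin (n lam))

namespace StateGenerator

variable (G : StateGenerator)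

/-- `Pr[k ← KeyGen(1^lam)]`. -/
def keyProb (lam : ℕ) (k : Key lam) : ℝ := (G.keyState lam k k).re

/-- `Pr[⊤ ← Ver(k, φ_k) : k ← KeyGen(1^lam), φ_k ← StateGen(k)]`. -/
def correctProb (lam : ℕ) : ℝ :=
  ∑ k : Key lam, G.keyProb lam k * acceptProb (G.ver lam k) (G.φ lam k)

/-- Non-uniform QPT adversaries that receive `t lam` copies of `φ_k` and output a key. -/
abbrev Inverter (t : ℕ → ℕ) : Type :=
  Adversary (fun lam => Fin (t lam) × Fin (G.n lam)) (fun lam => lam)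

/-- `Pr[⊤ ← Ver(k', φ_k) : k ← KeyGen(1^lam), φ_k ← StateGen(k), k' ← A(1^lam, φ_k^{⊗ t})]`. -/
def successProb {t : ℕ → ℕ} (A : G.Inverter t) (lam : ℕ) : ℝ :=
  ∑ k : Key lam, G.keyProb lam k * ∑ k' : Key lam,
    A.prob lam (tensorPow (G.φ lam k) (t lam)) k' * acceptProb (G.ver lam k') (G.φ lam k)

/-- IV-OWSGs: `KeyGen` and `StateGen` are uniform QPT algorithms, whereas `Ver` may be any
measurement; correctness and security (one-wayness) hold. -/
structure IsIVOWSG : Prop where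
  keyGen_qpt : UniformQPTGenerates (fun _ => Unit) (fun _ _ => []) (fun lam => lam)
    (fun lam _ => G.keyState lam)
  stateGen_qpt : UniformQPTGenerates Key (fun _ k => List.ofFn k) G.n G.φ
  ver_povm : ∀ lam k, IsPOVMElement (G.ver lam k)
  correctness : ∃ ν : ℕ → ℝ, Negligible ν ∧ ∀ lam, 1 - ν lam ≤ G.correctProb lam
  security : ∀ t : ℕ → ℕ, PolyBounded t → ∀ A : G.Inverter t,
    ∃ ν : ℕ → ℝ, Negligible ν ∧ ∀ lam, G.successProb A lam ≤ ν lam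

end StateGenerator

end QCrypto

end

noncomputable section

open scoped MatrixOrder ComplexOrder

set_option linter.unusedSectionVars false

namespace QCrypto

/-! The key is a uniform string k of λ bits, and φ_k encodes each bit k_i by a block of λ^d copies
of ξ_{k_i}, where d = 2c + 2 and λ^{-c} bounds the trace distance δ from below. Verification of k'
tests each block for the bit k'_i. Since it may be inefficient, an optimal test is available: the
Helstrom projector on each copy (`exists_helstrom`), then a likelihood ratio test on the results
(`exists_likelihood_test`). Bhattacharyya coefficients multiply, so a block is misjudged with
probability at most ε = (1 - δ²/4)^(λ^d), eventually below 2^{-λ}. Hence the true key passes with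
probability at least 1 - λε, whereas a key k' ≠ k must provoke an error in some block and passes
with probability at most ε. Up to ε, inverting therefore means outputting k exactly.

For security, t copies of φ_k form a product of N = t·λ·λ^d slots, each holding ξ_0 or ξ_1. A hybrid
argument over the slots (`exists_distinguisher`) replaces them all by ξ_0. The resulting state is
independent of k, so a uniform k is then hit with probability exactly 2^{-λ}. The reduction never
runs the verification; its advice contains the states in all slots but one.

The adversary outputs λ bits and a distinguisher only one. The probability of a string is a Fourier
average of signed parities (`ite_eq_sum_sgn`), so a bound on the change of every parity bounds the
change for every string without loss, and a parity is computed by a few controlled-not gates. For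
each λ the best of the finitely many choices of parity, slot and hybrid is hard-wired, which gives
one distinguisher for all keys.

Uniform generation needs an explicit program. It runs the given generator on both bits and
concatenates copies of the two circuit descriptions with shifted wire addresses.
`preparedState_productCircuit` says what such a concatenation prepares, and
`encodeCircuit_productCircuit` identifies the bits that are written with its description. -/

open scoped Matrix.Norms.L2Operator in
theorem exists_eq_conjTranspose_mul_self {n : Type*} [Fintype n] [DecidableEq n]
    {A : Matrix n n ℂ} (h : A.PosSemidef) : ∃ B : Matrix n n ℂ, A = B.conjTranspose * B :=
  CStarAlgebra.nonneg_iff_eq_star_mul_self.1 h.nonneg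

/-! ### Relabelling and tensor products of families -/

section TensorFamilies

variable {W V : Type} {S : Type} {X : S → Type}

/-- The state `ρ` on a register whose qubits have been renamed along `e`. -/
def relabel (e : W ≃ V) (ρ : Op W) : Op V :=
  ρ.submatrix (e.symm.arrowCongr (Equiv.refl Bool)) (e.symm.arrowCongr (Equiv.refl Bool))

theorem relabel_apply (e : W ≃ V) (ρ : Op W) (x y : V → Bool) :
    relabel e ρ x y = ρ (x ∘ e) (y ∘ e) := rfl

/-- The tensor product of a family of operators. -/
def tensorFam [Fintype S] (ρ : ∀ s, Op (X s)) : Op (Σ s, X s) :=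
  fun x y => ∏ s, ρ s (fun w => x ⟨s, w⟩) (fun w => y ⟨s, w⟩)

/-- Distributivity: a basis string of the joint register is a choice of one string per factor.
Products, traces and partial traces of tensor families all reduce to this. -/
theorem sum_prod_sigma [Fintype S] [DecidableEq S] [∀ s, Fintype (X s)] [∀ s, DecidableEq (X s)]
    {R : Type*} [CommSemiring R] (f : ∀ s, (X s → Bool) → R) :
    ∑ x : (Σ s, X s) → Bool, ∏ s, f s (fun w => x ⟨s, w⟩) = ∏ s, ∑ y, f s y := by
  rw [Finset.prod_univ_sum, Fintype.piFinset_univ]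
  exact Fintype.sum_equiv (Equiv.piCurry fun _ _ => Bool) _ _ fun x => rfl

section

variable [Fintype S] [DecidableEq S] [∀ s, Fintype (X s)] [∀ s, DecidableEq (X s)]

theorem tensorFam_mul (A B : ∀ s, Op (X s)) :
    tensorFam A * tensorFam B = tensorFam fun s => A s * B s := by
  ext x y
  simp only [Matrix.mul_apply, tensorFam, ← Finset.prod_mul_distrib]
  exact sum_prod_sigma fun s z => A s (fun w => x ⟨s, w⟩) z * B s z fun w => y ⟨s, w⟩

theorem tensorFam_one : tensorFam (fun s => (1 : Op (X s))) = 1 := by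
  ext x y
  simp only [tensorFam, Matrix.one_apply]
  split_ifs with h
  · subst h
    simp
  · obtain ⟨⟨s, w⟩, hw⟩ := Function.ne_iff.1 h
    exact Finset.prod_eq_zero (Finset.mem_univ s) (if_neg fun e => hw (congrFun e w))

theorem tensorFam_conjTranspose (A : ∀ s, Op (X s)) :
    (tensorFam A).conjTranspose = tensorFam fun s => (A s).conjTranspose := by
  ext x y
  simp [tensorFam, Matrix.conjTranspose_apply]

theorem trace_tensorFam (A : ∀ s, Op (X s)) : (tensorFam A).trace = ∏ s, (A s).trace :=
  sum_prod_sigma fun s z => A s z z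

theorem posSemidef_tensorFam {A : ∀ s, Op (X s)} (h : ∀ s, (A s).PosSemidef) :
    (tensorFam A).PosSemidef := by
  choose B hB using fun s => exists_eq_conjTranspose_mul_self (h s)
  have : tensorFam A = (tensorFam B).conjTranspose * tensorFam B := by
    rw [tensorFam_conjTranspose, tensorFam_mul]
    exact congrArg _ (funext hB)
  exact this ▸ Matrix.posSemidef_conjTranspose_mul_self _

theorem isState_tensorFam {ρ : ∀ s, Op (X s)} (h : ∀ s, IsState (ρ s)) :
    IsState (tensorFam ρ) :=
  ⟨posSemidef_tensorFam fun s => (h s).1, by simp [trace_tensorFam, (h _).2]⟩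

end

/-! ### Renaming of qubits, binary tensor products and basic constructions of states. -/

variable [Fintype W] [DecidableEq W] [Fintype V] [DecidableEq V]

theorem relabel_mul (e : W ≃ V) (A B : Op W) : relabel e (A * B) = relabel e A * relabel e B :=
  (Matrix.submatrix_mul_equiv A B _ _ _).symm

theorem relabel_one (e : W ≃ V) : relabel e (1 : Op W) = 1 :=
  Matrix.submatrix_one_equiv _

theorem relabel_conjTranspose (e : W ≃ V) (A : Op W) :
    (relabel e A).conjTranspose = relabel e A.conjTranspose := rfl

theorem trace_relabel (e : W ≃ V) (A : Op W) : (relabel e A).trace = A.trace :=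
  Equiv.sum_comp (e.symm.arrowCongr (Equiv.refl Bool)) fun x => A x x

theorem posSemidef_relabel (e : W ≃ V) {A : Op W} (h : A.PosSemidef) :
    (relabel e A).PosSemidef := h.submatrix _

theorem isState_relabel (e : W ≃ V) {ρ : Op W} (h : IsState ρ) : IsState (relabel e ρ) :=
  ⟨posSemidef_relabel e h.1, (trace_relabel e ρ).trans h.2⟩

theorem acceptProb_relabel (e : W ≃ V) (E ρ : Op W) :
    acceptProb (relabel e E) (relabel e ρ) = acceptProb E ρ := by
  rw [acceptProb, ← relabel_mul, trace_relabel, acceptProb]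

theorem tensor_mul (A B : Op W) (A' B' : Op V) :
    tensor A A' * tensor B B' = tensor (A * B) (A' * B') := by
  ext x y
  simp only [Matrix.mul_apply, tensor, Finset.sum_mul_sum, ← Fintype.sum_prod_type']
  refine Fintype.sum_equiv (Equiv.sumArrowEquivProdArrow W V Bool) _ _ fun z => ?_
  exact mul_mul_mul_comm _ _ _ _

theorem trace_tensor (A : Op W) (B : Op V) : (tensor A B).trace = A.trace * B.trace := by
  simp only [Matrix.trace, Matrix.diag_apply, tensor, Finset.sum_mul_sum,
    ← Fintype.sum_prod_type']
  exact Fintype.sum_equiv (Equiv.sumArrowEquivProdArrow W V Bool) _ _ fun z => rfl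

theorem posSemidef_tensor {A : Op W} {B : Op V} (hA : A.PosSemidef) (hB : B.PosSemidef) :
    (tensor A B).PosSemidef := by
  obtain ⟨C, rfl⟩ := exists_eq_conjTranspose_mul_self hA
  obtain ⟨D, rfl⟩ := exists_eq_conjTranspose_mul_self hB
  have : tensor C.conjTranspose D.conjTranspose = (tensor C D).conjTranspose := by
    ext x y
    simp [tensor, Matrix.conjTranspose_apply]
  rw [← tensor_mul, this]
  exact Matrix.posSemidef_conjTranspose_mul_self _

theorem isState_tensor {ρ : Op W} {σ : Op V} (hρ : IsState ρ) (hσ : IsState σ) :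
    IsState (tensor ρ σ) :=
  ⟨posSemidef_tensor hρ.1 hσ.1, by rw [trace_tensor, hρ.2, hσ.2, one_mul]⟩

theorem isState_partialTrace {ρ : Op (W ⊕ V)} (h : IsState ρ) : IsState (partialTrace ρ) := by
  constructor
  -- Each value z of the discarded register contributes a submatrix of ρ, so positivity is
  -- inherited.
  · have : partialTrace ρ = ∑ z : V → Bool,
        ρ.submatrix (fun x => Sum.elim x z) (fun x => Sum.elim x z) := by
      ext x y
      simp [partialTrace, Matrix.sum_apply]
    rw [this]
    exact Matrix.posSemidef_sum _ fun z _ => h.1.submatrix _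
  · rw [← h.2]
    simp only [Matrix.trace, Matrix.diag_apply, partialTrace, ← Fintype.sum_prod_type']
    exact (Fintype.sum_equiv (Equiv.sumArrowEquivProdArrow W V Bool) _ _ fun z => by
      simp [Equiv.sumArrowEquivProdArrow]).symm

theorem isState_zeroState : IsState (zeroState W) := by
  constructor
  · have h : zeroState W = Matrix.diagonal (Pi.single (fun _ => false) 1) :=
      (Matrix.diagonal_single _ _).symm
    rw [h]
    refine Matrix.PosSemidef.diagonal fun i => ?_
    rw [Pi.single_apply]
    split_ifs <;> simp
  · simp [zeroState]

theorem isState_conj {U ρ : Op W} (hU : U.conjTranspose * U = 1) (h : IsState ρ) :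
    IsState (U * ρ * U.conjTranspose) := by
  refine ⟨h.1.mul_mul_conjTranspose_same U, ?_⟩
  rw [Matrix.trace_mul_comm, ← mul_assoc, hU, one_mul, h.2]

end TensorFamilies

/-! ### Probabilities -/

section Probabilities

variable {W : Type} [Fintype W] [DecidableEq W]

theorem trace_mul_nonneg {A B : Op W} (hA : A.PosSemidef) (hB : B.PosSemidef) :
    0 ≤ (A * B).trace := by
  obtain ⟨C, rfl⟩ := exists_eq_conjTranspose_mul_self hA
  rw [mul_assoc, Matrix.trace_mul_comm]
  exact (hB.mul_mul_conjTranspose_same C).trace_nonneg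

theorem acceptProb_nonneg {E ρ : Op W} (hE : IsPOVMElement E) (hρ : IsState ρ) :
    0 ≤ acceptProb E ρ :=
  (Complex.le_def.1 (trace_mul_nonneg hE.1 hρ.1)).1

theorem acceptProb_one_sub {E ρ : Op W} (hρ : IsState ρ) :
    acceptProb (1 - E) ρ = 1 - acceptProb E ρ := by
  rw [acceptProb, sub_mul, one_mul, Matrix.trace_sub, hρ.2, acceptProb, Complex.sub_re,
    Complex.one_re]

theorem acceptProb_le_one {E ρ : Op W} (hE : IsPOVMElement E) (hρ : IsState ρ) :
    acceptProb E ρ ≤ 1 := by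
  have h : 0 ≤ acceptProb (1 - E) ρ := (Complex.le_def.1 (trace_mul_nonneg hE.2 hρ.1)).1
  rw [acceptProb_one_sub hρ] at h
  linarith

/-- The trace is already real. Taking real parts is not multiplicative, so this is what lets
acceptance probabilities multiply over tensor factors. -/
theorem acceptProb_coe {E ρ : Op W} (hE : E.PosSemidef) (hρ : ρ.PosSemidef) :
    (E * ρ).trace = (acceptProb E ρ : ℂ) :=
  Complex.ext rfl (by simpa using (Complex.le_def.1 (trace_mul_nonneg hE hρ)).2.symm)

/-- The expectation of the function `g` of the result of measuring all qubits of `ρ`. -/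
def expect (g : (W → Bool) → ℝ) (ρ : Op W) : ℝ := ∑ x, g x * (ρ x x).re

theorem outcomeProb_eq_expect {m : ℕ} (ρ : Op W) (out : Fin m → W) (z : Fin m → Bool) :
    outcomeProb ρ out z = expect (fun x => if x ∘ out = z then 1 else 0) ρ := by
  simp [outcomeProb, expect]

theorem diag_re_nonneg {ρ : Op W} (hρ : IsState ρ) (x : W → Bool) : 0 ≤ (ρ x x).re :=
  (Complex.le_def.1 hρ.1.diag_nonneg).1

theorem expect_one {ρ : Op W} (hρ : IsState ρ) : expect (fun _ => 1) ρ = 1 := by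
  have := congrArg Complex.re hρ.2
  simpa [expect, Matrix.trace] using this

theorem outcomeProb_nonneg {m : ℕ} {ρ : Op W} (hρ : IsState ρ) (out : Fin m → W)
    (z : Fin m → Bool) : 0 ≤ outcomeProb ρ out z :=
  Finset.sum_nonneg fun x _ => by
    split_ifs
    · exact diag_re_nonneg hρ x
    · exact le_rfl

theorem sum_outcomeProb {m : ℕ} {ρ : Op W} (hρ : IsState ρ) (out : Fin m → W) :
    ∑ z, outcomeProb ρ out z = 1 := by
  rw [← expect_one hρ]
  simp only [outcomeProb, expect]
  rw [Finset.sum_comm]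
  simp

theorem expect_relabel {V : Type} [Fintype V] [DecidableEq V] (e : W ≃ V) (g : (V → Bool) → ℝ)
    (ρ : Op W) : expect g (relabel e ρ) = expect (fun x => g (x ∘ e.symm)) ρ := by
  refine Fintype.sum_equiv (e.symm.arrowCongr (Equiv.refl Bool)) _ _ fun x => ?_
  simp only [relabel_apply]
  congr 2
  funext v
  simp

end Probabilities

/-! ### Unitarity of circuits -/

section Unitarity

variable {W : Type} [Fintype W] [DecidableEq W]

theorem onQubit_mul (U V : Matrix Bool Bool ℂ) (q : W) :
    onQubit U q * onQubit V q = onQubit (U * V) q := by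
  ext x y
  rw [Matrix.mul_apply]
  symm
  have hsum : onQubit (U * V) q x y =
      ∑ b, if ∀ w, w ≠ q → x w = y w then U (x q) b * V b (y q) else 0 := by
    rw [onQubit]
    split_ifs <;> simp [Matrix.mul_apply]
  rw [hsum]
  -- Only intermediate strings that agree with x off q contribute; they are indexed by their bit at
  -- q.
  refine Finset.sum_of_injOn (fun b => Function.update x q b) ?_ (fun _ _ => by simp) ?_ ?_
  · intro b _ b' _ h
    simpa using congrFun h q
  · intro z _ hz
    have h : ¬ ∀ w, w ≠ q → x w = z w := fun h => hz ⟨z q, by simp, by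
      funext w
      by_cases hw : w = q
      · subst hw
        simp
      · simp [hw, h w hw]⟩
    simp [onQubit, h]
  · intro b _
    have h : ∀ w, w ≠ q → x w = Function.update x q b w := fun w hw => by simp [hw]
    have h' : (∀ w, w ≠ q → Function.update x q b w = y w) ↔ ∀ w, w ≠ q → x w = y w :=
      forall₂_congr fun w hw => by simp [hw]
    simp only [onQubit, if_pos h, h', Function.update_self]
    split_ifs <;> simp

theorem onQubit_one (q : W) : onQubit 1 q = 1 := by
  ext x y
  rw [onQubit, Matrix.one_apply, Matrix.one_apply]
  by_cases h : x = y
  · simp [h]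
  · rw [if_neg h]
    split_ifs with h₁ h₂
    · exact absurd (funext fun w => if hw : w = q then hw ▸ h₂ else h₁ w hw) h
    · rfl
    · rfl

theorem onQubit_conjTranspose (U : Matrix Bool Bool ℂ) (q : W) :
    (onQubit U q).conjTranspose = onQubit U.conjTranspose q := by
  ext x y
  simp only [Matrix.conjTranspose_apply, onQubit, eq_comm]
  split_ifs <;> simp

theorem onBasis_conjTranspose_mul_self {f : (W → Bool) → W → Bool} (hf : Function.Injective f) :
    (onBasis f).conjTranspose * onBasis f = 1 := by
  ext x y
  simp [Matrix.mul_apply, Matrix.conjTranspose_apply, onBasis, Matrix.one_apply, hf.eq_iff,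
    eq_comm]

/-- Conjugating by a permutation matrix permutes indices by the inverse of f, which is f itself. -/
theorem onBasis_conj {f : (W → Bool) → W → Bool} (hf : Function.Involutive f) (ρ : Op W)
    (x y : W → Bool) :
    (onBasis f * ρ * (onBasis f).conjTranspose) x y = ρ (f x) (f y) := by
  have h (x z) : onBasis f x z = if z = f x then 1 else 0 :=
    if_congr ⟨fun h => by rw [h, hf], fun h => by rw [h, hf]⟩ rfl rfl
  simp [Matrix.mul_apply, Matrix.conjTranspose_apply, h]

theorem hadamardMatrix_unitary : hadamardMatrix.conjTranspose * hadamardMatrix = 1 := by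
  have h : ((Real.sqrt 2 : ℝ) : ℂ)⁻¹ * ((Real.sqrt 2 : ℝ) : ℂ)⁻¹ = 1 / 2 := by
    rw [← mul_inv, ← Complex.ofReal_mul, Real.mul_self_sqrt (by norm_num)]
    norm_num
  ext a b
  cases a <;> cases b <;>
    (simp [Matrix.mul_apply, hadamardMatrix, Matrix.conjTranspose_apply, h]; try norm_num)

theorem tMatrix_unitary : tMatrix.conjTranspose * tMatrix = 1 := by
  rw [tMatrix, Matrix.diagonal_conjTranspose, Matrix.diagonal_mul_diagonal, ← Matrix.diagonal_one]
  congr 1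
  funext b
  cases b
  · simp
  · simp only [Pi.star_apply, if_true, RCLike.star_def, ← Complex.exp_conj, ← Complex.exp_add,
      map_mul, Complex.conj_ofReal, Complex.conj_I]
    simp

theorem involutive_update_xor (t : W) (g : (W → Bool) → Bool)
    (hg : ∀ y b, g (Function.update y t b) = g y) :
    Function.Involutive fun y : W → Bool => Function.update y t (xor (y t) (g y)) := by
  intro y
  simp [hg]

theorem involutive_cnot {c t : W} (h : c ≠ t) :
    Function.Involutive fun y : W → Bool => Function.update y t (xor (y t) (y c)) :=
  involutive_update_xor t (fun y => y c) fun y b => by simp [h]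

theorem Gate.toOp_unitary (g : Gate W) : g.toOp.conjTranspose * g.toOp = 1 := by
  cases g with
  | H q => rw [toOp, onQubit_conjTranspose, onQubit_mul, hadamardMatrix_unitary, onQubit_one]
  | T q => rw [toOp, onQubit_conjTranspose, onQubit_mul, tMatrix_unitary, onQubit_one]
  | CNOT c t h => exact onBasis_conjTranspose_mul_self (involutive_cnot h).injective
  | CCNOT c₁ c₂ t h h₁ h₂ =>
    exact onBasis_conjTranspose_mul_self
      (involutive_update_xor t (fun y => y c₁ && y c₂) fun y b => by simp [h₁, h₂]).injective

theorem circuitOp_unitary (C : List (Gate W)) :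
    (circuitOp C).conjTranspose * circuitOp C = 1 := by
  induction C with
  | nil => simp [circuitOp]
  | cons g C ih =>
    rw [circuitOp, Matrix.conjTranspose_mul, mul_assoc, ← mul_assoc _ (circuitOp C), ih, one_mul,
      g.toOp_unitary]

theorem isState_runCircuit (C : List (Gate W)) {ρ : Op W} (h : IsState ρ) :
    IsState (runCircuit C ρ) :=
  isState_conj (circuitOp_unitary C) h

theorem circuitOp_append (C D : List (Gate W)) :
    circuitOp (C ++ D) = circuitOp D * circuitOp C := by
  induction C with
  | nil => simp [circuitOp]
  | cons g C ih => rw [List.cons_append, circuitOp, ih, circuitOp, mul_assoc]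

theorem runCircuit_append (C D : List (Gate W)) (ρ : Op W) :
    runCircuit (C ++ D) ρ = runCircuit D (runCircuit C ρ) := by
  simp only [runCircuit, circuitOp_append, Matrix.conjTranspose_mul, mul_assoc]

theorem isState_preparedState {n a : ℕ} (C : List (Gate (Fin n ⊕ Fin a))) :
    IsState (preparedState C) :=
  isState_partialTrace (isState_runCircuit C isState_zeroState)

end Unitarity

/-! ### Renaming the qubits of a circuit -/

section Renaming

variable {W V : Type} [Fintype W] [DecidableEq W] [Fintype V] [DecidableEq V]

/-- The gate `g` acting on qubits that have been renamed along `ι`. -/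
def Gate.map {W V : Type} (ι : W ↪ V) : Gate W → Gate V
  | .H q => .H (ι q)
  | .T q => .T (ι q)
  | .CNOT c t h => .CNOT (ι c) (ι t) (ι.injective.ne h)
  | .CCNOT c₁ c₂ t h h₁ h₂ => .CCNOT (ι c₁) (ι c₂) (ι t) (ι.injective.ne h) (ι.injective.ne h₁)
      (ι.injective.ne h₂)

theorem Gate.map_map {W V U : Type} (ι : W ↪ V) (κ : V ↪ U) (g : Gate W) :
    (g.map ι).map κ = g.map (ι.trans κ) := by
  cases g <;> rfl

open Classical in
/-- The operator `A` applied to the qubits in the range of `ι`, tensored with the identity. -/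
def embedOp (ι : W ↪ V) (A : Op W) : Op V :=
  fun x y => if ∀ v, v ∉ Set.range ι → x v = y v then A (x ∘ ι) (y ∘ ι) else 0

theorem onQubit_map (ι : W ↪ V) (U : Matrix Bool Bool ℂ) (q : W) :
    onQubit U (ι q) = embedOp ι (onQubit U q) := by
  ext x y
  simp only [onQubit, embedOp, ← ite_and]
  refine if_congr ⟨fun h => ⟨fun v hv => h v ?_, fun w hw => h _ (ι.injective.ne hw)⟩,
    fun h v hv => ?_⟩ rfl rfl
  · rintro rfl
    exact hv ⟨q, rfl⟩
  · by_cases hr : v ∈ Set.range ι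
    · obtain ⟨w, rfl⟩ := hr
      exact h.2 w fun e => hv (congrArg ι e)
    · exact h.1 v hr

/-- Covers both controlled gates: each overwrites one target bit by a function of the bits it sees.
-/
theorem onBasis_map (ι : W ↪ V) (t : W) (g : (W → Bool) → Bool) :
    onBasis (fun y : V → Bool => Function.update y (ι t) (g (y ∘ ι))) =
      embedOp ι (onBasis fun y => Function.update y t (g y)) := by
  ext x y
  simp only [onBasis, embedOp, ← ite_and]
  refine if_congr ⟨fun h => ⟨fun v hv => ?_, ?_⟩, fun h => funext fun v => ?_⟩ rfl rfl
  · rw [h, Function.update_of_ne]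
    rintro rfl
    exact hv ⟨t, rfl⟩
  · rw [h, Function.update_comp_eq_of_injective _ ι.injective]
  · by_cases hr : v ∈ Set.range ι
    · obtain ⟨w, rfl⟩ := hr
      rw [← Function.comp_apply (f := x), h.2,
        ← Function.update_comp_eq_of_injective _ ι.injective]
      rfl
    · rw [h.1 v hr, Function.update_of_ne]
      rintro rfl
      exact hr ⟨t, rfl⟩

theorem Gate.toOp_map (ι : W ↪ V) (g : Gate W) : (g.map ι).toOp = embedOp ι g.toOp := by
  cases g with
  | H q => exact onQubit_map ι _ q
  | T q => exact onQubit_map ι _ q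
  | CNOT c t h => exact onBasis_map ι t fun y => xor (y t) (y c)
  | CCNOT c₁ c₂ t h h₁ h₂ => exact onBasis_map ι t fun y => xor (y t) (y c₁ && y c₂)

theorem embedOp_equiv (e : W ≃ V) (A : Op W) : embedOp e.toEmbedding A = relabel e A := by
  ext x y
  have h : ∀ v, v ∉ Set.range e.toEmbedding → x v = y v := fun v hv => by simp at hv
  rw [embedOp, if_pos h]
  rfl

theorem circuitOp_map_equiv (e : W ≃ V) (C : List (Gate W)) :
    circuitOp (C.map (Gate.map e.toEmbedding)) = relabel e (circuitOp C) := by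
  induction C with
  | nil => exact (relabel_one e).symm
  | cons g C ih =>
    rw [List.map_cons, circuitOp, ih, Gate.toOp_map, embedOp_equiv, ← relabel_mul, circuitOp]

theorem runCircuit_map_equiv (e : W ≃ V) (C : List (Gate W)) (ρ : Op W) :
    runCircuit (C.map (Gate.map e.toEmbedding)) (relabel e ρ) = relabel e (runCircuit C ρ) := by
  simp only [runCircuit, circuitOp_map_equiv, relabel_mul, relabel_conjTranspose]

end Renaming

/-! ### Circuits on disjoint registers -/

section Product

variable {S : Type} [Fintype S] [DecidableEq S] {X : S → Type} [∀ s, Fintype (X s)]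
  [∀ s, DecidableEq (X s)]

/-- Acting on one register means tensoring with identities on all others. In this form, circuits on
different registers multiply factor by factor. -/
theorem embedOp_sigmaMk (s : S) (A : Op (X s)) :
    embedOp (Function.Embedding.sigmaMk s) A =
      tensorFam (Function.update (fun s => (1 : Op (X s))) s A) := by
  ext x y
  rw [tensorFam, Fintype.prod_eq_mul_prod_compl s, Function.update_self, embedOp]
  split_ifs with h
  · rw [Finset.prod_eq_one, mul_one]
    · rfl
    · intro s' hs'
      have hs' : s' ≠ s := by simpa using hs'
      rw [Function.update_of_ne hs', Matrix.one_apply, if_pos]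
      funext w
      refine h _ ?_
      rintro ⟨w', hw'⟩
      exact hs' (congrArg Sigma.fst hw').symm
  · push Not at h
    obtain ⟨⟨s', w⟩, hv, hne⟩ := h
    have hs' : s' ≠ s := by
      rintro rfl
      exact hv ⟨w, rfl⟩
    rw [Finset.prod_eq_zero (i := s') (by simpa using hs'), mul_zero]
    rw [Function.update_of_ne hs', Matrix.one_apply, if_neg]
    exact fun e => hne (congrFun e w)

theorem circuitOp_map_sigmaMk (s : S) (C : List (Gate (X s))) :
    circuitOp (C.map (Gate.map (Function.Embedding.sigmaMk s))) =
      tensorFam (Function.update (fun s => (1 : Op (X s))) s (circuitOp C)) := by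
  induction C with
  | nil =>
    rw [circuitOp, Function.update_eq_self s (fun s => (1 : Op (X s)))]
    exact tensorFam_one.symm
  | cons g C ih =>
    rw [List.map_cons, circuitOp, ih, Gate.toOp_map, embedOp_sigmaMk, tensorFam_mul, circuitOp]
    congr 1
    funext s'
    by_cases hs : s' = s
    · subst hs
      simp
    · simp [hs]

/-- Since no register repeats in l, each tensor factor receives its circuit at most once. -/
theorem circuitOp_flatMap_sigmaMk (C : ∀ s, List (Gate (X s))) {l : List S} (hl : l.Nodup) :
    circuitOp (l.flatMap fun s => (C s).map (Gate.map (Function.Embedding.sigmaMk s))) =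
      tensorFam fun s => if s ∈ l then circuitOp (C s) else 1 := by
  induction l with
  | nil => simpa [circuitOp] using tensorFam_one.symm
  | cons s l ih =>
    obtain ⟨hs, hl⟩ := List.nodup_cons.1 hl
    rw [List.flatMap_cons, circuitOp_append, ih hl, circuitOp_map_sigmaMk, tensorFam_mul]
    congr 1
    funext s'
    by_cases h : s' = s
    · subst h
      simp [hs]
    · simp [h]

theorem runCircuit_flatMap_sigmaMk (C : ∀ s, List (Gate (X s))) {l : List S} (hl : l.Nodup)
    (hl' : ∀ s, s ∈ l) (ρ : ∀ s, Op (X s)) :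
    runCircuit (l.flatMap fun s => (C s).map (Gate.map (Function.Embedding.sigmaMk s)))
      (tensorFam ρ) = tensorFam fun s => runCircuit (C s) (ρ s) := by
  simp only [runCircuit, circuitOp_flatMap_sigmaMk C hl, hl', if_true, tensorFam_conjTranspose,
    tensorFam_mul]

theorem tensorFam_zeroState : tensorFam (fun s => zeroState (X s)) = zeroState (Σ s, X s) := by
  ext x y
  simp only [tensorFam, zeroState, Matrix.single_apply]
  split_ifs with h
  · obtain ⟨rfl, rfl⟩ := h
    simp
  · by_contra hne
    rw [← Ne, Finset.prod_ne_zero_iff] at hne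
    refine h ⟨funext fun v => ?_, funext fun v => ?_⟩
    · have := hne v.1 (Finset.mem_univ _)
      exact congrFun (not_not.1 fun h' => this (if_neg fun h'' => h' h''.1)) v.2
    · have := hne v.1 (Finset.mem_univ _)
      exact congrFun (not_not.1 fun h' => this (if_neg fun h'' => h' h''.2)) v.2

theorem relabel_zeroState {W V : Type} [Fintype W] [DecidableEq W] [Fintype V] [DecidableEq V]
    (e : W ≃ V) : relabel e (zeroState W) = zeroState V := by
  ext x y
  have h (x : V → Bool) : (fun _ => false) = x ∘ e ↔ (fun _ => false) = x := by
    rw [← Equiv.comp_symm_eq]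
    rfl
  simp only [relabel_apply, zeroState, Matrix.single_apply, h]

variable {n a : S → ℕ} {n' a' : ℕ}

/-- The wires of the disjoint union of registers of output and ancilla qubits. -/
def wires (eO : (Σ s, Fin (n s)) ≃ Fin n') (eA : (Σ s, Fin (a s)) ≃ Fin a') :
    (Σ s, Fin (n s) ⊕ Fin (a s)) ≃ Fin n' ⊕ Fin a' :=
  (Equiv.sigmaSumDistrib _ _).trans (Equiv.sumCongr eO eA)

/-- The wire of the disjoint union that corresponds to a wire of the register `s`. -/
def wireOf (eO : (Σ s, Fin (n s)) ≃ Fin n') (eA : (Σ s, Fin (a s)) ≃ Fin a') (s : S) :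
    Fin (n s) ⊕ Fin (a s) ↪ Fin n' ⊕ Fin a' :=
  (Function.Embedding.sigmaMk s).trans (wires eO eA).toEmbedding

/-- The circuits `C s` run on disjoint registers. -/
def productCircuit (eO : (Σ s, Fin (n s)) ≃ Fin n') (eA : (Σ s, Fin (a s)) ≃ Fin a')
    (l : List S) (C : ∀ s, List (Gate (Fin (n s) ⊕ Fin (a s)))) : List (Gate (Fin n' ⊕ Fin a')) :=
  l.flatMap fun s => (C s).map (Gate.map (wireOf eO eA s))

/-- Both the zero state and the unitary factor over the registers, and the sum over ancilla strings
factors by `sum_prod_sigma`. The partial trace of the product is thus the product of the partial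
traces. -/
theorem preparedState_productCircuit (eO : (Σ s, Fin (n s)) ≃ Fin n')
    (eA : (Σ s, Fin (a s)) ≃ Fin a') {l : List S} (hl : l.Nodup) (hl' : ∀ s, s ∈ l)
    (C : ∀ s, List (Gate (Fin (n s) ⊕ Fin (a s)))) :
    preparedState (productCircuit eO eA l C) =
      relabel eO (tensorFam fun s => preparedState (C s)) := by
  have hC : productCircuit eO eA l C =
      (l.flatMap fun s => (C s).map (Gate.map (Function.Embedding.sigmaMk s))).map
        (Gate.map (wires eO eA).toEmbedding) := by
    simp only [productCircuit, List.map_flatMap, List.map_map]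
    congr 1
    funext s
    congr 1
    funext g
    exact (Gate.map_map _ _ g).symm
  rw [preparedState, hC, ← relabel_zeroState (wires eO eA), runCircuit_map_equiv,
    ← tensorFam_zeroState, runCircuit_flatMap_sigmaMk C hl hl']
  ext x y
  have key := sum_prod_sigma (X := fun s => Fin (a s)) fun s z =>
    runCircuit (C s) (zeroState (Fin (n s) ⊕ Fin (a s)))
      (Sum.elim (fun w => x (eO ⟨s, w⟩)) z) (Sum.elim (fun w => y (eO ⟨s, w⟩)) z)
  rw [relabel_apply]
  refine Eq.trans ?_ key
  refine Fintype.sum_equiv (eA.symm.arrowCongr (Equiv.refl Bool)) _ _ fun z => ?_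
  rw [relabel_apply]
  refine Finset.prod_congr rfl fun s _ => ?_
  congr 1 <;> funext w <;> rcases w with w | w <;> rfl

end Product

/-! ### Optimal distinguishing measurement -/

section Helstrom

variable {W : Type} [Fintype W] [DecidableEq W]

open scoped Matrix.Norms.L2Operator in
/-- The projector onto the nonnegative eigenspaces of `ρ - σ` attains the trace distance. -/
theorem exists_helstrom {ρ σ : Op W} (hρ : IsState ρ) (hσ : IsState σ) :
    ∃ M : Op W, IsPOVMElement M ∧ acceptProb M ρ - acceptProb M σ = traceDist ρ σ := by
  set D := ρ - σ with hD
  have hsa : IsSelfAdjoint D := hρ.1.1.isSelfAdjoint.sub hσ.1.1.isSelfAdjoint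
  -- The spectrum is finite, so the functional calculus applies even to the discontinuous step
  -- function f.
  have hcont (f : ℝ → ℝ) : ContinuousOn f (spectrum ℝ D) :=
    (Matrix.finite_real_spectrum (A := D)).continuousOn f
  set f : ℝ → ℝ := fun x => if 0 ≤ x then 1 else 0
  -- Pointwise |x| = 2 f(x) x - x. Because D has trace zero, half the trace of |D| is the trace of
  -- f(D) D.
  have habs : CFC.abs D = cfc f D * D + cfc f D * D - D := by
    have hid : D = cfc (fun x : ℝ => x) D := (cfc_id' ℝ D).symm
    have hmul : cfc f D * D = cfc (fun x => f x * x) D := by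
      rw [cfc_mul f (fun x => x) D (hcont _) (hcont _), ← hid]
    have hsub : cfc (fun x => f x * x + f x * x - x) D =
        cfc (fun x => f x * x) D + cfc (fun x => f x * x) D - D := by
      rw [cfc_sub (fun x => f x * x + f x * x) (fun x => x) D (hcont _) (hcont _),
        cfc_add D (fun x => f x * x) (fun x => f x * x) (hcont _) (hcont _), ← hid]
    rw [CFC.abs_eq_cfc_norm D hsa, hmul, ← hsub]
    congr 1
    funext x
    rw [Real.norm_eq_abs]
    by_cases hx : 0 ≤ x
    · simp [f, hx, abs_of_nonneg]
    · simp [f, hx, abs_of_neg (not_le.1 hx)]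
  refine ⟨cfc f D, ⟨?_, ?_⟩, ?_⟩
  · exact Matrix.nonneg_iff_posSemidef.1
      (cfc_nonneg (a := D) (f := f) fun x _ => by simp only [f]; split_ifs <;> simp)
  · exact Matrix.le_iff.1 (cfc_le_one f D fun x _ => by simp only [f]; split_ifs <;> simp)
  · have htr : D.trace = 0 := by rw [hD, Matrix.trace_sub, hρ.2, hσ.2, sub_self]
    rw [traceDist, traceNorm, ← hD, habs, Matrix.trace_sub, Matrix.trace_add, htr, acceptProb,
      acceptProb, ← Complex.sub_re, ← Matrix.trace_sub, ← mul_sub, ← hD, sub_zero, Complex.add_re]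
    ring

end Helstrom

/-! ### Product measurements -/

section ProductMeasurement

variable {S : Type} [Fintype S] [DecidableEq S] {X : S → Type} [∀ s, Fintype (X s)]
  [∀ s, DecidableEq (X s)]

theorem tensorFam_sum {R : Type} [Fintype R] (A : ∀ s, R → Op (X s)) :
    tensorFam (fun s => ∑ b, A s b) = ∑ z : S → R, tensorFam fun s => A s (z s) := by
  ext x y
  simp only [tensorFam, Matrix.sum_apply, Finset.prod_univ_sum, Fintype.piFinset_univ]

theorem isPOVMElement_sum_tensorFam {A : ∀ s, Bool → Op (X s)}
    (hA : ∀ s b, (A s b).PosSemidef) (hA' : ∀ s, ∑ b, A s b = 1) (Z : Finset (S → Bool)) :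
    IsPOVMElement (∑ z ∈ Z, tensorFam fun s => A s (z s)) := by
  refine ⟨Matrix.posSemidef_sum _ fun z _ => posSemidef_tensorFam fun s => hA s _, ?_⟩
  have h : (1 : Op (Σ s, X s)) - ∑ z ∈ Z, (tensorFam fun s => A s (z s)) =
      ∑ z ∈ Zᶜ, tensorFam fun s => A s (z s) := by
    rw [sub_eq_iff_eq_add, add_comm, Finset.sum_add_sum_compl, ← tensorFam_sum]
    simp only [hA']
    exact tensorFam_one.symm
  rw [h]
  exact Matrix.posSemidef_sum _ fun z _ => posSemidef_tensorFam fun s => hA s _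

theorem acceptProb_tensorFam {E ρ : ∀ s, Op (X s)} (hE : ∀ s, (E s).PosSemidef)
    (hρ : ∀ s, (ρ s).PosSemidef) :
    acceptProb (tensorFam E) (tensorFam ρ) = ∏ s, acceptProb (E s) (ρ s) := by
  have h : (tensorFam E * tensorFam ρ).trace = ((∏ s, acceptProb (E s) (ρ s) : ℝ) : ℂ) := by
    rw [tensorFam_mul, trace_tensorFam, Complex.ofReal_prod]
    exact Finset.prod_congr rfl fun s _ => acceptProb_coe (hE s) (hρ s)
  rw [acceptProb, h, Complex.ofReal_re]

/-- The two effects of the measurement with accepting effect `E`. -/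
def effect {W : Type} [Fintype W] [DecidableEq W] (E : Op W) (b : Bool) : Op W := if b then E else 1 - E

theorem sum_effect {W : Type} [Fintype W] [DecidableEq W] (E : Op W) : ∑ b, effect E b = 1 := by
  simp [effect]

theorem IsPOVMElement.effect {W : Type} [Fintype W] [DecidableEq W] {E : Op W}
    (hE : IsPOVMElement E) (b : Bool) : IsPOVMElement (effect E b) := by
  cases b
  · simpa [QCrypto.effect, IsPOVMElement] using hE.symm
  · simpa [QCrypto.effect] using hE

theorem isPOVMElement_tensorFam {E : ∀ s, Op (X s)} (hE : ∀ s, IsPOVMElement (E s)) :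
    IsPOVMElement (tensorFam E) := by
  have h := isPOVMElement_sum_tensorFam (A := fun s => effect (E s))
    (fun s b => ((hE s).effect b).1) (fun s => sum_effect (E s)) {fun _ => true}
  simpa [effect] using h

theorem isPOVMElement_relabel {W V : Type} [Fintype W] [DecidableEq W] [Fintype V] [DecidableEq V]
    (e : W ≃ V) {E : Op W} (hE : IsPOVMElement E) : IsPOVMElement (relabel e E) := by
  refine ⟨posSemidef_relabel e hE.1, ?_⟩
  have : (1 : Op V) - relabel e E = relabel e (1 - E) := by
    rw [← relabel_one e]
    rfl
  exact this ▸ posSemidef_relabel e hE.2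

end ProductMeasurement

/-! ### Amplification -/

section Amplification

/-- The likelihood ratio test for two product distributions errs with a probability that decays
exponentially, by multiplicativity of the Bhattacharyya coefficient. -/
theorem exists_likelihood_test {J : Type} [Fintype J] [DecidableEq J] (q : Bool → Bool → ℝ)
    (hq : ∀ b c, 0 ≤ q b c) (hsum : ∀ b, q b true + q b false = 1) :
    ∃ Z : Finset (J → Bool),
      (∑ y ∈ Z, ∏ j, q false (y j) ≤ (1 - (q true true - q false true) ^ 2 / 4) ^ Fintype.card J) ∧
      ∑ y ∈ Zᶜ, ∏ j, q true (y j) ≤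
        (1 - (q true true - q false true) ^ 2 / 4) ^ Fintype.card J := by
  classical
  set P : Bool → (J → Bool) → ℝ := fun b y => ∏ j, q b (y j) with hP
  set R : (J → Bool) → ℝ := fun y => ∏ j, √(q false (y j) * q true (y j)) with hR
  have hP0 (b y) : 0 ≤ P b y := Finset.prod_nonneg fun j _ => hq _ _
  have hR0 (y) : 0 ≤ R y := Finset.prod_nonneg fun j _ => Real.sqrt_nonneg _
  have hR2 (y) : R y ^ 2 = P false y * P true y := by
    simp only [hR, hP, ← Finset.prod_pow, ← Finset.prod_mul_distrib]
    exact Finset.prod_congr rfl fun j _ => Real.sq_sqrt (mul_nonneg (hq _ _) (hq _ _))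
  -- The Bhattacharyya coefficient of the product distributions is the power of the coefficient for
  -- one bit.
  have hRsum : ∑ y, R y ≤ (1 - (q true true - q false true) ^ 2 / 4) ^ Fintype.card J := by
    have h1 : ∑ y, R y = ∏ _j : J, ∑ c, √(q false c * q true c) := by
      rw [Finset.prod_univ_sum, Fintype.piFinset_univ]
    rw [h1, Finset.prod_const, Finset.card_univ, Fintype.sum_bool]
    refine pow_le_pow_left₀ (by positivity) ?_ _
    -- With a = √u and b = √v, the gap between the means is (a - b)²/2, while (v - u)² = (a - b)²(a
    -- + b)² and (a + b)² ≤ 4.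
    have aux (u v : ℝ) (hu : 0 ≤ u) (hu1 : u ≤ 1) (hv : 0 ≤ v) (hv1 : v ≤ 1) :
        √(u * v) ≤ (u + v) / 2 - (v - u) ^ 2 / 8 := by
      rw [Real.sqrt_mul hu]
      have hu' := Real.sq_sqrt hu
      have hv' := Real.sq_sqrt hv
      have h1 := Real.sqrt_le_one.2 hu1
      have h2 := Real.sqrt_le_one.2 hv1
      have h3 := Real.sqrt_nonneg u
      have h4 := Real.sqrt_nonneg v
      set a := √u
      set b := √v
      rw [← hu', ← hv']
      have h5 : (a + b) ^ 2 ≤ 4 := by nlinarith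
      nlinarith [mul_nonneg (sq_nonneg (a - b)) (sub_nonneg.2 h5)]
    have hle (b c) : q b c ≤ 1 := by
      cases c <;> linarith [hsum b, hq b true, hq b false]
    have e1 := aux _ _ (hq false true) (hle _ _) (hq true true) (hle _ _)
    have e2 := aux _ _ (hq false false) (hle _ _) (hq true false) (hle _ _)
    have e3 : q true false - q false false = -(q true true - q false true) := by
      linarith [hsum true, hsum false]
    rw [e3, neg_sq] at e2
    linarith [hsum true, hsum false]
  -- On either side of the test the mass counted as error is the smaller of the two, hence at most
  -- their geometric mean R.
  refine ⟨Finset.univ.filter fun y => P false y ≤ P true y, ?_, ?_⟩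
  · refine (Finset.sum_le_sum fun y hy => ?_).trans
      ((Finset.sum_le_univ_sum_of_nonneg hR0).trans hRsum)
    refine le_of_sq_le_sq ?_ (hR0 y)
    rw [hR2]
    have := (Finset.mem_filter.1 hy).2
    change P false y ^ 2 ≤ _
    rw [sq]
    exact mul_le_mul_of_nonneg_left this (hP0 _ _)
  · refine (Finset.sum_le_sum fun y hy => ?_).trans
      ((Finset.sum_le_univ_sum_of_nonneg hR0).trans hRsum)
    refine le_of_sq_le_sq ?_ (hR0 y)
    rw [hR2]
    have : P true y ≤ P false y := by simpa using le_of_lt (by simpa using hy)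
    change P true y ^ 2 ≤ _
    rw [sq]
    exact mul_le_mul_of_nonneg_right this (hP0 _ _)

variable {W : Type} [Fintype W] [DecidableEq W]

/-- Many copies of two states are distinguished up to an error decaying exponentially. -/
theorem exists_amplified_test {ξ : Bool → Op W} (hξ : ∀ b, IsState (ξ b)) (m : ℕ) :
    ∃ E : Op (Σ _ : Fin m, W), IsPOVMElement E ∧
      ∀ b, acceptProb (effect E (!b)) (tensorFam fun _ => ξ b) ≤
        (1 - traceDist (ξ false) (ξ true) ^ 2 / 4) ^ m := by
  obtain ⟨M, hM, hdist⟩ := exists_helstrom (hξ false) (hξ true)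
  obtain ⟨Z, h0, h1⟩ := exists_likelihood_test (J := Fin m)
    (fun b c => acceptProb (effect M c) (ξ b)) (fun b c => acceptProb_nonneg (hM.effect c) (hξ b))
    (fun b => by simp [effect, acceptProb_one_sub (hξ b)])
  have hsq : (acceptProb (effect M true) (ξ true) - acceptProb (effect M true) (ξ false)) ^ 2 =
      traceDist (ξ false) (ξ true) ^ 2 := by
    rw [← hdist, ← neg_sq, neg_sub]
    simp [effect]
  rw [hsq, Fintype.card_fin] at h0 h1
  set T : (Fin m → Bool) → Op (Σ _ : Fin m, W) := fun z => tensorFam fun s => effect M (z s)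
  have hprob (Z : Finset (Fin m → Bool)) (b : Bool) :
      acceptProb (∑ z ∈ Z, T z) (tensorFam fun _ => ξ b) =
        ∑ y ∈ Z, ∏ j, acceptProb (effect M (y j)) (ξ b) := by
    rw [acceptProb, Finset.sum_mul, Matrix.trace_sum, Complex.re_sum]
    exact Finset.sum_congr rfl fun y _ =>
      acceptProb_tensorFam (fun s => (hM.effect _).1) fun s => (hξ b).1
  have hcompl : effect (∑ z ∈ Z, T z) false = ∑ z ∈ Zᶜ, T z := by
    have : (1 : Op (Σ _ : Fin m, W)) = ∑ z, T z := by
      rw [← tensorFam_sum]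
      simp only [sum_effect]
      exact tensorFam_one.symm
    simp only [effect, this]
    rw [← Finset.sum_add_sum_compl Z]
    simp
  refine ⟨∑ z ∈ Z, T z, isPOVMElement_sum_tensorFam (A := fun _ => effect M)
    (fun _ b => (hM.effect b).1) (fun _ => sum_effect M) Z, fun b => ?_⟩
  cases b
  · simpa [effect, hprob] using h0
  · rw [Bool.not_true, hcompl, hprob]
    exact h1

end Amplification

/-! ### Parities of measurement results -/

section Parity

/-- The sign `(-1)^b`. -/
def sgn (b : Bool) : ℝ := if b then -1 else 1

theorem sgn_xor (b c : Bool) : sgn (xor b c) = sgn b * sgn c := by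
  cases b <;> cases c <;> simp [sgn]

theorem abs_sgn (b : Bool) : |sgn b| = 1 := by
  cases b <;> simp [sgn]

/-- Fourier expansion of an indicator function on the hypercube. -/
theorem ite_eq_sum_sgn {m : ℕ} (u z : Fin m → Bool) :
    (if u = z then (1 : ℝ) else 0) =
      (1 / 2) ^ m * ∑ r : Finset (Fin m), (∏ i ∈ r, sgn (z i)) * ∏ i ∈ r, sgn (u i) := by
  have h1 : ∑ r : Finset (Fin m), (∏ i ∈ r, sgn (z i)) * ∏ i ∈ r, sgn (u i) =
      ∏ i, (1 + sgn (z i) * sgn (u i)) := by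
    rw [Finset.prod_one_add, Finset.powerset_univ]
    exact Finset.sum_congr rfl fun r _ => Finset.prod_mul_distrib.symm
  rw [h1]
  split_ifs with h
  · subst h
    have h2 (b : Bool) : 1 + sgn b * sgn b = 2 := by cases b <;> norm_num [sgn]
    simp [h2]
  · obtain ⟨i, hi⟩ := Function.ne_iff.1 h
    rw [Finset.prod_eq_zero (Finset.mem_univ i), mul_zero]
    cases hu : u i <;> cases hz : z i <;> simp_all [sgn]

variable {W : Type} [Fintype W] [DecidableEq W]

/-- Heisenberg picture: the gate only permutes the diagonal of ρ, so the permutation can be moved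
onto the classical function g. -/
theorem expect_runCircuit_cnot {c t : W} (h : c ≠ t) (g : (W → Bool) → ℝ) (ρ : Op W) :
    expect g (runCircuit [.CNOT c t h] ρ) =
      expect (fun x => g (Function.update x t (xor (x t) (x c)))) ρ := by
  have hi := involutive_cnot h
  refine Fintype.sum_equiv hi.toPerm _ _ fun x => ?_
  simp only [runCircuit, circuitOp, one_mul, Gate.toOp]
  rw [onBasis_conj hi]
  exact congrArg (fun y => g y * _) (hi x).symm

/-- The circuit that adds the qubits in the list `cs` to the qubit `t`. -/
def xorInto (t : W) (cs : List W) : List (Gate W) :=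
  cs.flatMap fun c => if h : c ≠ t then [.CNOT c t h] else []

theorem length_xorInto_le (t : W) (cs : List W) : (xorInto t cs).length ≤ cs.length := by
  induction cs with
  | nil => simp [xorInto]
  | cons c cs ih =>
    rw [xorInto, List.flatMap_cons, List.length_append, List.length_cons, add_comm]
    refine Nat.add_le_add ih ?_
    split_ifs <;> simp

/-- Each gate multiplies the sign of the target by the sign of its control. The controls differ from
t, so earlier gates leave them unchanged. -/
theorem expect_runCircuit_xorInto (t : W) {cs : List W} (ht : t ∉ cs) (ρ : Op W) :
    expect (fun x => sgn (x t)) (runCircuit (xorInto t cs) ρ) =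
      expect (fun x => sgn (x t) * (cs.map fun c => sgn (x c)).prod) ρ := by
  induction cs generalizing ρ with
  | nil => simp [xorInto, runCircuit, circuitOp]
  | cons c cs ih =>
    have hct : c ≠ t := fun h => ht (h ▸ List.mem_cons_self)
    have ht' : t ∉ cs := fun h => ht (List.mem_cons_of_mem _ h)
    rw [xorInto, List.flatMap_cons, dif_pos hct, runCircuit_append, ← xorInto, ih ht',
      expect_runCircuit_cnot]
    congr 1
    funext x
    have hmap : (cs.map fun d => sgn (Function.update x t (xor (x t) (x c)) d)) =
        cs.map fun d => sgn (x d) :=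
      List.map_congr_left fun d hd => by
        rw [Function.update_of_ne (fun h : d = t => ht' (h ▸ hd))]
    rw [hmap, Function.update_self, sgn_xor, List.map_cons, List.prod_cons, mul_assoc]

theorem outcomeProb_true {ρ : Op W} (hρ : IsState ρ) (out : Fin 1 → W) :
    outcomeProb ρ out (fun _ => true) = (1 - expect (fun x => sgn (x (out 0))) ρ) / 2 := by
  rw [← expect_one hρ, outcomeProb_eq_expect, expect, expect, expect, ← Finset.sum_sub_distrib,
    Finset.sum_div]
  refine Finset.sum_congr rfl fun x _ => ?_
  have h : x ∘ out = (fun _ => true) ↔ x (out 0) = true :=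
    ⟨fun h => congrFun h 0, fun h => funext fun i => by rw [Subsingleton.elim i 0]; exact h⟩
  simp only [h]
  cases x (out 0) <;> simp [sgn]

end Parity

/-! ### Adversaries for a single security parameter -/

/-- A circuit with quantum advice whose output is a string of `m` bits. -/
structure Device (V : Type) [Fintype V] [DecidableEq V] (m : ℕ) where
  qubits : ℕ
  advice : Op (Fin qubits)
  isState : IsState advice
  circuit : List (Gate (V ⊕ Fin qubits))
  out : Fin m ↪ V ⊕ Fin qubits

section Devices

variable {V : Type} [Fintype V] [DecidableEq V] {m : ℕ}

/-- The state in which the output qubits of the device are measured. -/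
def Device.final (A : Device V m) (ρ : Op V) : Op (V ⊕ Fin A.qubits) :=
  runCircuit A.circuit (tensor ρ A.advice)

/-- The probability that the device outputs `z` on the input state `ρ`. -/
def Device.prob (A : Device V m) (ρ : Op V) (z : Fin m → Bool) : ℝ :=
  outcomeProb (A.final ρ) A.out z

theorem Device.isState_final (A : Device V m) {ρ : Op V} (h : IsState ρ) : IsState (A.final ρ) :=
  isState_runCircuit _ (isState_tensor h A.isState)

theorem Device.prob_nonneg (A : Device V m) {ρ : Op V} (h : IsState ρ) (z : Fin m → Bool) :
    0 ≤ A.prob ρ z :=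
  outcomeProb_nonneg (A.isState_final h) _ _

theorem Device.sum_prob (A : Device V m) {ρ : Op V} (h : IsState ρ) : ∑ z, A.prob ρ z = 1 :=
  sum_outcomeProb (A.isState_final h) _

/-- The expected sign of the parity of the output bits with index in `r`. -/
def Device.bias (A : Device V m) (ρ : Op V) (r : Finset (Fin m)) : ℝ :=
  expect (fun x => ∏ i ∈ r, sgn (x (A.out i))) (A.final ρ)

/-- Fourier inversion on the output string, applied under the expectation. -/
theorem Device.prob_eq_sum_bias (A : Device V m) (ρ : Op V) (z : Fin m → Bool) :
    A.prob ρ z = (1 / 2) ^ m * ∑ r, (∏ i ∈ r, sgn (z i)) * A.bias ρ r := by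
  simp only [Device.prob, outcomeProb_eq_expect, expect, ite_eq_sum_sgn, Device.bias,
    Finset.mul_sum, Finset.sum_mul]
  rw [Finset.sum_comm]
  refine Finset.sum_congr rfl fun r _ => Finset.sum_congr rfl fun x _ => ?_
  simp only [Function.comp_apply]
  ring

theorem Device.bias_empty (A : Device V m) {ρ : Op V} (h : IsState ρ) : A.bias ρ ∅ = 1 := by
  simpa [Device.bias] using expect_one (A.isState_final h)

/-- There are 2^m parities, each of weight 2^{-m} up to sign, so passing from parities to strings
costs no factor. -/
theorem Device.prob_sub_le (A : Device V m) {ρ σ : Op V} {δ : ℝ}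
    (h : ∀ r, |A.bias ρ r - A.bias σ r| ≤ δ) (z : Fin m → Bool) :
    A.prob ρ z - A.prob σ z ≤ δ := by
  rw [A.prob_eq_sum_bias, A.prob_eq_sum_bias, ← mul_sub, ← Finset.sum_sub_distrib]
  have hsum : ∑ r : Finset (Fin m), ((∏ i ∈ r, sgn (z i)) * A.bias ρ r -
      (∏ i ∈ r, sgn (z i)) * A.bias σ r) ≤ ∑ _r : Finset (Fin m), δ := by
    refine Finset.sum_le_sum fun r _ => ?_
    rw [← mul_sub]
    refine (le_abs_self _).trans ?_
    rw [abs_mul, Finset.abs_prod]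
    simpa [abs_sgn] using h r
  calc _ ≤ (1 / 2 : ℝ) ^ m * ∑ _r : Finset (Fin m), δ :=
        mul_le_mul_of_nonneg_left hsum (by positivity)
    _ = δ := by simp

/-- A device without advice or gates. -/
def Device.trivial (n : ℕ) : Device (Fin n) 1 where
  -- A measured qubit is required even when n = 0, so one ancilla is supplied as the output.
  qubits := 1
  advice := zeroState _
  isState := isState_zeroState
  circuit := []
  out := ⟨fun i => Sum.inr i, Sum.inr_injective⟩

end Devices

/-! ### The hybrid argument -/

section Hybrid

variable {S : Type} [Fintype S] [DecidableEq S] {V : Type} [Fintype V] [DecidableEq V] {n m : ℕ}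

/-- The product state with `ξ (b s)` at the place `s`. -/
def slotState (e : (Σ _ : S, Fin n) ≃ V) (ξ : Bool → Op (Fin n)) (b : S → Bool) : Op V :=
  relabel e (tensorFam fun s => ξ (b s))

theorem isState_slotState (e : (Σ _ : S, Fin n) ≃ V) {ξ : Bool → Op (Fin n)}
    (hξ : ∀ b, IsState (ξ b)) (b : S → Bool) : IsState (slotState e ξ b) :=
  isState_relabel e (isState_tensorFam fun _ => hξ _)

/-- Splitting off the register `j`. -/
def splitAt (S : Type) [DecidableEq S] (n : ℕ) (j : S) :
    Fin n ⊕ (Σ _ : {s : S // s ≠ j}, Fin n) ≃ Σ _ : S, Fin n :=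
  Equiv.ofBijective (Sum.elim (fun w => ⟨j, w⟩) fun p => ⟨p.1.1, p.2⟩) <| by
    constructor
    · rintro (w | ⟨⟨s, hs⟩, w⟩) (w' | ⟨⟨s', hs'⟩, w'⟩) h
      · simpa using h
      · exact absurd (congrArg Sigma.fst h).symm hs'
      · exact absurd (congrArg Sigma.fst h) hs
      · simpa using h
    · rintro ⟨s, w⟩
      by_cases hs : s = j
      · exact ⟨Sum.inl w, by simp [hs]⟩
      · exact ⟨Sum.inr ⟨⟨s, hs⟩, w⟩, rfl⟩

/-- The wires of a device, with the input register `j` separated from all other ones. -/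
def hybridWires (e : (Σ _ : S, Fin n) ≃ V) (q : ℕ) (j : S) :
    Fin n ⊕ Fin (Fintype.card ((Σ _ : {s : S // s ≠ j}, Fin n) ⊕ Fin q)) ≃ V ⊕ Fin q :=
  ((Equiv.sumCongr (Equiv.refl _) (Fintype.equivFin _).symm).trans
    (Equiv.sumAssoc _ _ _).symm).trans
      (Equiv.sumCongr ((splitAt S n j).trans e) (Equiv.refl _))

/-- The advice consisting of the states at all places except `j` and of the state `σ`. -/
def hybridAdvice {q : ℕ} (ξ : Bool → Op (Fin n)) (σ : Op (Fin q)) (b : S → Bool) (j : S) :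
    Op (Fin (Fintype.card ((Σ _ : {s : S // s ≠ j}, Fin n) ⊕ Fin q))) :=
  relabel (Fintype.equivFin _) (tensor (tensorFam fun s : {s : S // s ≠ j} => ξ (b s)) σ)

theorem relabel_symm_relabel {W V : Type} (e : W ≃ V) (A : Op W) :
    relabel e.symm (relabel e A) = A := by
  ext x y
  simp [relabel_apply, Function.comp_assoc]

/-- After regrouping wires, slot j becomes the challenge and everything else the advice. The advice
does not depend on c, so both neighbouring hybrids use the same one. -/
theorem tensor_slotState_update (e : (Σ _ : S, Fin n) ≃ V) {q : ℕ} (ξ : Bool → Op (Fin n))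
    (σ : Op (Fin q)) (b : S → Bool) (j : S) (c : Bool) :
    relabel (hybridWires e q j).symm (tensor (slotState e ξ (Function.update b j c)) σ) =
      tensor (ξ c) (hybridAdvice ξ σ b j) := by
  rw [← relabel_symm_relabel (hybridWires e q j) (tensor (ξ c) (hybridAdvice ξ σ b j))]
  congr 1
  ext x y
  simp only [relabel_apply, tensor, slotState, tensorFam, hybridAdvice]
  rw [Fintype.prod_eq_mul_prod_subtype_ne _ j, Function.update_self, mul_assoc]
  congr 1
  congr 1
  · refine Finset.prod_congr rfl fun s _ => ?_
    rw [Function.update_of_ne s.2]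
    congr 1 <;> funext w <;> simp only [Function.comp_apply, hybridWires] <;> simp <;> rfl
  · congr 1 <;> funext w <;> simp [hybridWires]

/-- Computing a parity of the outputs of a device turns it into a distinguisher. -/
theorem exists_device_bias (e : (Σ _ : S, Fin n) ≃ V) {ξ : Bool → Op (Fin n)}
    (hξ : ∀ b, IsState (ξ b)) (A : Device V m) (r : Finset (Fin m)) (j : S) (b : S → Bool) :
    ∃ B : Device (Fin n) 1, B.qubits ≤ Fintype.card S * n + A.qubits + 1 ∧
      B.circuit.length ≤ A.circuit.length + m ∧
      |A.bias (slotState e ξ (Function.update b j false)) r -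
          A.bias (slotState e ξ (Function.update b j true)) r| ≤
        2 * |B.prob (ξ false) (fun _ => true) - B.prob (ξ true) fun _ => true| := by
  -- The empty parity has bias 1 on every state. Otherwise some output i in r can accumulate the
  -- parity of the others.
  rcases r.eq_empty_or_nonempty with rfl | ⟨i, hi⟩
  · refine ⟨Device.trivial n, by simp [Device.trivial], by simp [Device.trivial], ?_⟩
    rw [A.bias_empty (isState_slotState e hξ _), A.bias_empty (isState_slotState e hξ _), sub_self,
      abs_zero]
    positivity
  set cs : List (V ⊕ Fin A.qubits) := (r.erase i).toList.map A.out with hcs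
  have hi' : A.out i ∉ cs := by simp [hcs]
  have hadv : IsState (hybridAdvice ξ A.advice b j) :=
    isState_relabel _ (isState_tensor (isState_tensorFam fun _ => hξ _) A.isState)
  let h := hybridWires e A.qubits j
  let B : Device (Fin n) 1 :=
    { qubits := _
      advice := hybridAdvice ξ A.advice b j
      isState := hadv
      circuit := (A.circuit ++ xorInto (A.out i) cs).map (Gate.map h.symm.toEmbedding)
      out := ⟨fun _ => h.symm (A.out i), fun _ _ _ => Subsingleton.elim _ _⟩ }
  -- The probability of reading 1 is (1 - bias)/2; this is the source of the factor 2 in the bound.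
  have hB (c : Bool) : B.prob (ξ c) (fun _ => true) =
      (1 - A.bias (slotState e ξ (Function.update b j c)) r) / 2 := by
    rw [Device.prob, outcomeProb_true (B.isState_final (hξ c))]
    congr 2
    have h1 : B.final (ξ c) = relabel h.symm (runCircuit (xorInto (A.out i) cs)
        (A.final (slotState e ξ (Function.update b j c)))) := by
      rw [Device.final, Device.final, ← runCircuit_append, ← runCircuit_map_equiv,
        tensor_slotState_update]
    rw [h1, expect_relabel]
    have h2 : (fun x : V ⊕ Fin A.qubits → Bool => sgn ((x ∘ h.symm.symm) (B.out 0))) =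
        fun x => sgn (x (A.out i)) := by
      funext x
      exact congrArg (fun v => sgn (x v)) (h.apply_symm_apply _)
    rw [h2, expect_runCircuit_xorInto _ hi', Device.bias]
    congr 1
    funext x
    rw [← Finset.mul_prod_erase r _ hi, hcs, List.map_map, Finset.prod_map_toList]
    rfl
  refine ⟨B, ?_, ?_, ?_⟩
  · have h1 : Fintype.card {s : S // s ≠ j} ≤ Fintype.card S := Fintype.card_subtype_le _
    have h2 : B.qubits = Fintype.card {s : S // s ≠ j} * n + A.qubits := by
      change Fintype.card _ = _
      simp
    rw [h2]
    have := Nat.mul_le_mul_right n h1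
    omega
  · have h1 := length_xorInto_le (A.out i) cs
    have h2 : cs.length ≤ m := by
      rw [hcs, List.length_map, Finset.length_toList]
      exact (Finset.card_le_univ _).trans_eq (Fintype.card_fin m)
    simp only [B, List.length_map, List.length_append]
    omega
  · rw [hB, hB, ← sub_div, abs_div, abs_two, mul_div_cancel₀ _ two_ne_zero]
    rw [sub_sub_sub_cancel_left, abs_sub_comm]

/-- The hybrid argument proper: coordinates of b are replaced by those of b' one at a time, with T
the set already replaced. -/
theorem abs_sub_le_card_mul (F : (S → Bool) → ℝ) {δ : ℝ}
    (h : ∀ b j, |F (Function.update b j false) - F (Function.update b j true)| ≤ δ)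
    (b b' : S → Bool) : |F b - F b'| ≤ Fintype.card S * δ := by
  have step (b : S → Bool) (j : S) (c : Bool) (hδ : 0 ≤ δ) :
      |F b - F (Function.update b j c)| ≤ δ := by
    have hb : F b = F (Function.update b j (b j)) := by rw [Function.update_eq_self]
    rw [hb]
    have := h b j
    cases b j <;> cases c
    · simpa using hδ
    · exact this
    · rwa [abs_sub_comm]
    · simpa using hδ
  have key (T : Finset S) : |F b - F (T.piecewise b' b)| ≤ T.card * δ := by
    induction T using Finset.induction_on with
    | empty => simp
    | insert j T hj ih =>
      rw [Finset.piecewise_insert, Finset.card_insert_of_notMem hj]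
      -- Nonnegativity of δ needs a coordinate to test; for empty S it may fail, and the bound is
      -- then zero.
      have hδ : 0 ≤ δ := (abs_nonneg _).trans (h b j)
      have := step (T.piecewise b' b) j (b' j) hδ
      calc _ ≤ |F b - F (T.piecewise b' b)| + |F (T.piecewise b' b) -
            F (Function.update (T.piecewise b' b) j (b' j))| := abs_sub_le _ _ _
        _ ≤ T.card * δ + δ := add_le_add ih this
        _ = _ := by push_cast; ring
  simpa [Finset.piecewise_univ] using key Finset.univ

/-- The output distribution of a device on a product state changes by at most the advantage of
a distinguisher times twice the number of places. -/
theorem exists_distinguisher (e : (Σ _ : S, Fin n) ≃ V) {ξ : Bool → Op (Fin n)}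
    (hξ : ∀ b, IsState (ξ b)) (A : Device V m) :
    ∃ B : Device (Fin n) 1, B.qubits ≤ Fintype.card S * n + A.qubits + 1 ∧
      B.circuit.length ≤ A.circuit.length + m ∧
      ∀ b b' z, A.prob (slotState e ξ b) z ≤ A.prob (slotState e ξ b') z +
        2 * Fintype.card S * |B.prob (ξ false) (fun _ => true) - B.prob (ξ true) fun _ => true| := by
  choose B hB using fun p : Finset (Fin m) × S × (S → Bool) =>
    exists_device_bias e hξ A p.1 p.2.1 p.2.2
  let adv (B : Device (Fin n) 1) : ℝ :=
    |B.prob (ξ false) (fun _ => true) - B.prob (ξ true) fun _ => true|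
  -- The best of the finitely many parity distinguishers serves all b, b' and z at once. There are
  -- none only if S is empty, where any device will do.
  obtain ⟨B₀, h₁, h₂, h₃⟩ : ∃ B₀ : Device (Fin n) 1,
      B₀.qubits ≤ Fintype.card S * n + A.qubits + 1 ∧
      B₀.circuit.length ≤ A.circuit.length + m ∧ ∀ p, adv (B p) ≤ adv B₀ := by
    rcases isEmpty_or_nonempty (Finset (Fin m) × S × (S → Bool)) with hE | hE
    · exact ⟨Device.trivial n, by simp [Device.trivial], by simp [Device.trivial],
        fun p => hE.elim p⟩
    · obtain ⟨p, hp⟩ := Finite.exists_max fun p => adv (B p)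
      exact ⟨B p, (hB p).1, (hB p).2.1, hp⟩
  refine ⟨B₀, h₁, h₂, fun b b' z => ?_⟩
  rw [← sub_le_iff_le_add']
  refine A.prob_sub_le (fun r => ?_) z
  refine (abs_sub_le_card_mul (fun b => A.bias (slotState e ξ b) r) (δ := 2 * adv B₀)
    (fun b j => ?_) b b').trans_eq ?_
  · exact (hB (r, j, b)).2.2.trans (mul_le_mul_of_nonneg_left (h₃ _) zero_le_two)
  · ring

end Hybrid

/-! ### Running times of programs -/

namespace Cmd

/-- Started on `s`, the program `p` halts within `T` steps with `s'`. -/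
def Within (p : Cmd) (T : ℕ) (s s' : Store) : Prop := ∃ k ≤ T, p.Runs s k s'

variable {p q : Cmd} {s s' s'' : Store} {T T' : ℕ}

theorem Within.mono (h : p.Within T s s') (hT : T ≤ T') : p.Within T' s s' :=
  let ⟨k, hk, hr⟩ := h
  ⟨k, hk.trans hT, hr⟩

theorem Within.conv (h : p.Within T s s') (hT : T ≤ T') (hs : ∀ r, s' r = s'' r) :
    p.Within T' s s'' :=
  (funext hs : s' = s'') ▸ h.mono hT

theorem Within.seq (h : p.Within T s s') (h' : q.Within T' s' s'') :
    (Cmd.seq p q).Within (T + T') s s'' :=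
  let ⟨_, hk, hr⟩ := h
  let ⟨_, hk', hr'⟩ := h'
  ⟨_, Nat.add_le_add hk hk', hr.seq hr'⟩

theorem within_skip (s : Store) : Cmd.skip.Within 1 s s := ⟨1, le_rfl, .skip s⟩

theorem within_push (s : Store) (r : ℕ) (b : Bool) :
    (Cmd.push r b).Within 1 s (Function.update s r (b :: s r)) := ⟨1, le_rfl, .push s r b⟩

theorem within_pop (s : Store) (r : ℕ) :
    (Cmd.pop r).Within 1 s (Function.update s r (s r).tail) := ⟨1, le_rfl, .pop s r⟩

theorem within_branch {r : ℕ} {p₀ p₁ p₂ : Cmd} {b : Bool} {l : List Bool} (hs : s r = b :: l)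
    (h : (if b then p₂ else p₁).Within T s s') : (Cmd.branch r p₀ p₁ p₂).Within (T + 1) s s' := by
  obtain ⟨k, hk, hr⟩ := h
  cases b
  · exact ⟨k + 1, by omega, .branchFalse (by rw [hs]; rfl) hr⟩
  · exact ⟨k + 1, by omega, .branchTrue (by rw [hs]; rfl) hr⟩

theorem within_loop_nil {r : ℕ} (hs : s r = []) : (Cmd.loop r p).Within 1 s s :=
  ⟨1, le_rfl, .loopDone hs⟩

theorem within_loop_cons {r : ℕ} (hs : s r ≠ []) (h : p.Within T s s')
    (h' : (Cmd.loop r p).Within T' s' s'') : (Cmd.loop r p).Within (T + T' + 1) s s'' :=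
  let ⟨_, hk, hr⟩ := h
  let ⟨_, hk', hr'⟩ := h'
  ⟨_, by omega, .loopStep hs hr hr'⟩

/-- One step pushes at most one bit. Running times thereby bound the sizes of the circuits written,
whose numbers of qubits are encoded in unary. -/
theorem Runs.length_le {k : ℕ} (h : p.Runs s k s') (r : ℕ) :
    (s' r).length ≤ (s r).length + k := by
  induction h with
  | skip s => omega
  | push s r' b =>
    by_cases hr : r = r'
    · subst hr
      simp
    · simp [hr]
  | pop s r' =>
    by_cases hr : r = r'
    · subst hr
      simp only [Function.update_self, List.length_tail]
      omega
    · simp [hr]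
  | loopDone _ => omega
  | seq _ _ ih₁ ih₂ => omega
  | branchEmpty _ _ ih => omega
  | branchFalse _ _ ih => omega
  | branchTrue _ _ ih => omega
  | loopStep _ _ _ ih₁ ih₂ => omega

/-- The program `p` with the stacks renamed by `f`. -/
def rename (f : ℕ → ℕ) : Cmd → Cmd
  | skip => .skip
  | push r b => .push (f r) b
  | pop r => .pop (f r)
  | seq p q => .seq (p.rename f) (q.rename f)
  | branch r p₀ p₁ p₂ => .branch (f r) (p₀.rename f) (p₁.rename f) (p₂.rename f)
  | loop r p => .loop (f r) (p.rename f)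

/-- A frame rule: the renamed program simulates the original on the range of f and touches nothing
else, so it can run inside a larger store. -/
theorem Runs.rename {f : ℕ → ℕ} (hf : Function.Injective f) {k : ℕ} (h : p.Runs s k s') :
    ∀ u : Store, u ∘ f = s → ∃ u' : Store, (p.rename f).Runs u k u' ∧ u' ∘ f = s' ∧
      ∀ r, r ∉ Set.range f → u' r = u r := by
  have hout (u : Store) (r : ℕ) (l : List Bool) :
      ∀ r', r' ∉ Set.range f → Function.update u (f r) l r' = u r' := fun r' hr' =>
    Function.update_of_ne (by rintro rfl; exact hr' ⟨r, rfl⟩) _ _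
  induction h with
  | skip s => exact fun u hu => ⟨u, .skip u, hu, fun _ _ => rfl⟩
  | push s r b =>
    rintro u rfl
    exact ⟨_, .push u (f r) b, Function.update_comp_eq_of_injective _ hf _ _, hout _ _ _⟩
  | pop s r =>
    rintro u rfl
    exact ⟨_, .pop u (f r), Function.update_comp_eq_of_injective _ hf _ _, hout _ _ _⟩
  | seq _ _ ih₁ ih₂ =>
    intro u hu
    obtain ⟨u₁, h₁, hu₁, hf₁⟩ := ih₁ u hu
    obtain ⟨u₂, h₂, hu₂, hf₂⟩ := ih₂ u₁ hu₁
    exact ⟨u₂, h₁.seq h₂, hu₂, fun r hr => (hf₂ r hr).trans (hf₁ r hr)⟩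
  | branchEmpty hs _ ih =>
    rintro u rfl
    obtain ⟨u₁, h₁, hu₁, hf₁⟩ := ih u rfl
    exact ⟨u₁, .branchEmpty hs h₁, hu₁, hf₁⟩
  | branchFalse hs _ ih =>
    rintro u rfl
    obtain ⟨u₁, h₁, hu₁, hf₁⟩ := ih u rfl
    exact ⟨u₁, .branchFalse hs h₁, hu₁, hf₁⟩
  | branchTrue hs _ ih =>
    rintro u rfl
    obtain ⟨u₁, h₁, hu₁, hf₁⟩ := ih u rfl
    exact ⟨u₁, .branchTrue hs h₁, hu₁, hf₁⟩
  | loopDone hs =>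
    rintro u rfl
    exact ⟨u, .loopDone hs, rfl, fun _ _ => rfl⟩
  | loopStep hs _ _ ih₁ ih₂ =>
    rintro u rfl
    obtain ⟨u₁, h₁, hu₁, hf₁⟩ := ih₁ u rfl
    obtain ⟨u₂, h₂, hu₂, hf₂⟩ := ih₂ u₁ hu₁
    exact ⟨u₂, .loopStep hs h₁ h₂, hu₂, fun r hr => (hf₂ r hr).trans (hf₁ r hr)⟩

/-! ### Elementary routines -/

/-- Push the bit `b` on the stacks in the list. -/
def pushAll (b : Bool) : List ℕ → Cmd
  | [] => .skip
  | y :: ys => .seq (.push y b) (pushAll b ys)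

theorem within_pushAll (b : Bool) {ys : List ℕ} (hys : ys.Nodup) (s : Store) :
    (pushAll b ys).Within (ys.length + 1) s fun r => if r ∈ ys then b :: s r else s r := by
  induction ys generalizing s with
  | nil => exact (within_skip s).conv (by simp) fun r => by simp
  | cons y ys ih =>
    obtain ⟨hy, hys⟩ := List.nodup_cons.1 hys
    refine Within.conv ((within_push s y b).seq (ih hys _)) (by simp; omega) fun r => ?_
    by_cases hr : r = y
    · subst hr
      simp [hy]
    · simp [hr]

/-- Move the contents of the stack `x`, reversed, to each of the stacks in the list. -/
def drain (x : ℕ) (ys : List ℕ) : Cmd :=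
  .loop x (.branch x .skip (.seq (.pop x) (pushAll false ys)) (.seq (.pop x) (pushAll true ys)))

theorem within_drain {x : ℕ} {ys : List ℕ} (hys : ys.Nodup) (hx : x ∉ ys) (s : Store) :
    (drain x ys).Within ((s x).length * (ys.length + 4) + 1) s fun r =>
      if r = x then [] else if r ∈ ys then (s x).reverse ++ s r else s r := by
  generalize hl : s x = l
  induction l generalizing s with
  | nil =>
    refine Within.conv (within_loop_nil hl) (by simp) fun r => ?_
    by_cases hr : r = x
    · simp [hr, hl]
    · simp [hr]
  | cons b l ih =>
    have hbody := (within_pop s x).seq (within_pushAll b hys _)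
    set s₁ : Store := fun r => if r ∈ ys then b :: Function.update s x (s x).tail r else
      Function.update s x (s x).tail r with hs₁
    have hb : (if b then Cmd.seq (.pop x) (pushAll true ys) else
        Cmd.seq (.pop x) (pushAll false ys)).Within (1 + (ys.length + 1)) s s₁ := by
      cases b <;> exact hbody
    have h1 : s₁ x = l := by simp [hs₁, hx, hl]
    refine Within.conv (within_loop_cons (by simp [hl]) (within_branch hl hb) (ih s₁ h1)) ?_
      fun r => ?_
    · rw [List.length_cons]
      linarith
    · by_cases hr : r = x
      · simp [hr]
      · by_cases hr' : r ∈ ys <;> simp [hr, hr', hs₁]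

/-- Push the contents of the stack `e` on the stack `x`, using the empty stack `t`. -/
def dup (e x t : ℕ) : Cmd := .seq (drain e [t]) (drain t [e, x])

/-- Each drain reverses, so the two cancel, and the second also restores e. The drains cost 5 and 6
steps per bit. -/
theorem within_dup {e x t : ℕ} (hex : e ≠ x) (het : e ≠ t) (hxt : x ≠ t) {s : Store}
    (ht : s t = []) :
    (dup e x t).Within ((s e).length * 11 + 2) s (Function.update s x (s e ++ s x)) := by
  have h1 := within_drain (x := e) (ys := [t]) (by simp) (by simpa using het) s
  have h2 := within_drain (x := t) (ys := [e, x]) (by simpa using hex)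
    (by simp [het.symm, hxt.symm])
    fun r => if r = e then [] else if r ∈ [t] then (s e).reverse ++ s r else s r
  refine Within.conv (h1.seq h2) ?_ fun r => ?_
  · simp [het.symm, ht]
    omega
  · by_cases hr : r = t
    · simp [hr, hxt.symm, ht]
    · by_cases hr' : r = x
      · subst hr'
        simp [hr, het.symm, hex.symm, ht]
      · by_cases hr'' : r = e <;> simp [hr, hr', hr'', het.symm, ht, het, hex]

/-- Move the ones on top of the stack `x` to the stack `d` and remove the zero below them, using
the empty stack `f`. -/
def readUnary (x d f : ℕ) : Cmd :=
  .seq (.push f true) (.loop f (.branch x (.pop f) (.seq (.pop x) (.pop f))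
    (.seq (.pop x) (.push d true))))

/-- The flag on f controls the loop, which therefore stops at the terminating zero and leaves the
rest l of the stack unread. -/
theorem within_readUnary {x d f : ℕ} (hxd : x ≠ d) (hxf : x ≠ f) (hdf : d ≠ f) {s : Store}
    {j : ℕ} {l : List Bool} (hx : s x = encodeUnary j ++ l) (hf : s f = []) :
    (readUnary x d f).Within (4 * j + 6) s
      (Function.update (Function.update s x l) d (List.replicate j true ++ s d)) := by
  have key (j : ℕ) : ∀ s : Store, s x = encodeUnary j ++ l → s f = [true] →
      (Cmd.loop f (.branch x (.pop f) (.seq (.pop x) (.pop f))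
        (.seq (.pop x) (.push d true)))).Within (4 * j + 5) s
        (Function.update (Function.update (Function.update s x l) d
          (List.replicate j true ++ s d)) f []) := by
    induction j with
    | zero =>
      intro s hx hf
      have hx' : s x = false :: l := by simpa [encodeUnary] using hx
      have hb := within_branch (p₀ := .pop f) (p₁ := .seq (.pop x) (.pop f))
        (p₂ := .seq (.pop x) (.push d true)) hx' ((within_pop s x).seq (within_pop _ f))
      refine Within.conv (within_loop_cons (by simp [hf]) hb
        (within_loop_nil (by simp [hxf.symm, hf]))) (by omega) fun r => ?_
      by_cases h1 : r = f
      · simp [h1, hf, hxf.symm]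
      · by_cases h2 : r = x
        · subst h2
          simp [h1, hxd, hx']
        · by_cases h3 : r = d
          · simp [h3, hdf, hxd.symm]
          · simp [h1, h2, h3]
    | succ j ih =>
      intro s hx hf
      have hx' : s x = true :: (encodeUnary j ++ l) := by
        simpa [encodeUnary, List.replicate_succ] using hx
      have hb := within_branch (p₀ := .pop f) (p₁ := .seq (.pop x) (.pop f))
        (p₂ := .seq (.pop x) (.push d true)) hx' ((within_pop s x).seq (within_push _ d true))
      refine Within.conv (within_loop_cons (by simp [hf]) hb (ih _ (by simp [hxd, hx'])
        (by simp [hdf.symm, hxf.symm, hf]))) (by omega) fun r => ?_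
      by_cases h1 : r = f
      · simp [h1]
      · by_cases h2 : r = x
        · subst h2
          simp [h1, hxd]
        · by_cases h3 : r = d
          · subst h3
            simp [h1, h2, List.replicate_succ']
          · simp [h1, h2, h3]
  refine Within.conv ((within_push s f true).seq (key j _ (by simp [hxf, hx]) (by simp [hf])))
    (by omega) fun r => ?_
  by_cases h1 : r = f
  · simp [h1, hdf.symm, hxf.symm, hf]
  · by_cases h2 : r = d
    · subst h2
      simp [h1]
    · by_cases h3 : r = x
      · simp [h3, hxd, hxf]
      · simp [h1, h2, h3]

end Cmd

/-! ### Assembling circuits on disjoint registers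

The programs below use the stacks `2` (number of copies in unary), `3` (number of output qubits of
one circuit), `4`, `5` (numbers of ancilla qubits), `6`, `7` (offsets of output and ancilla wires),
`8` (reversed result), `9`, `10` (auxiliary, empty between routines), `11` (gates that are being
processed), `12` (counter) and `14`, `15` (gates of the two circuits). -/

/-- The address of a wire in a copy of the register with offsets `o` and `a`. -/
def shiftWire {n k : ℕ} (o a : ℕ) : Fin n ⊕ Fin k → List Bool
  | .inl i => false :: encodeUnary (o + i)
  | .inr j => true :: encodeUnary (a + j)

/-- The description of a gate in a copy of the register with offsets `o` and `a`. -/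
def shiftGate {n k : ℕ} (o a : ℕ) : Gate (Fin n ⊕ Fin k) → List Bool
  | .H q => false :: false :: shiftWire o a q
  | .T q => false :: true :: shiftWire o a q
  | .CNOT c t _ => true :: false :: (shiftWire o a c ++ shiftWire o a t)
  | .CCNOT c₁ c₂ t _ _ _ =>
    true :: true :: (shiftWire o a c₁ ++ shiftWire o a c₂ ++ shiftWire o a t)

namespace Cmd

/-- The store `s` with `x` on the stack that is read and `acc` on the stack that is written. -/
def stream (s : Store) (x acc : List Bool) : Store :=
  Function.update (Function.update s 11 x) 8 acc

/-- Copy one bit and continue according to its value. -/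
def copyBit (c₀ c₁ : Cmd) : Cmd :=
  .branch 11 .skip (.seq (.pop 11) (.seq (.push 8 false) c₀))
    (.seq (.pop 11) (.seq (.push 8 true) c₁))

theorem within_copyBit {c₀ c₁ : Cmd} {s s' : Store} {b : Bool} {l acc : List Bool} {T : ℕ}
    (h : (if b then c₁ else c₀).Within T (stream s l (b :: acc)) s') :
    (copyBit c₀ c₁).Within (T + 3) (stream s (b :: l) acc) s' := by
  have h1 : (Cmd.pop 11).Within 1 (stream s (b :: l) acc) (stream s l acc) := by
    refine (within_pop _ 11).conv le_rfl fun r => ?_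
    by_cases h8 : r = 8
    · simp [stream, h8]
    · by_cases h11 : r = 11 <;> simp [stream, h8, h11]
  have h2 : (Cmd.push 8 b).Within 1 (stream s l acc) (stream s l (b :: acc)) := by
    refine (within_push _ 8 b).conv le_rfl fun r => ?_
    by_cases h8 : r = 8 <;> simp [stream, h8]
  have h3 : (if b then Cmd.seq (.pop 11) (.seq (.push 8 true) c₁) else
      Cmd.seq (.pop 11) (.seq (.push 8 false) c₀)).Within (1 + (1 + T)) (stream s (b :: l) acc) s' := by
    cases b <;> exact h1.seq (h2.seq h)
  exact (within_branch (l := l) (by simp [stream]) h3).mono (by omega)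

/-- Copy an index, adding the offset on the stack `off`. -/
def wireTail (off : ℕ) : Cmd := .seq (dup off 8 9) (.seq (readUnary 11 8 10) (.push 8 false))

/-- Addition in unary is concatenation: the ones of the offset and of the index are pushed, then the
closing zero. The code appears reversed because the output stack grows from its top. -/
theorem within_wireTail {off : ℕ} (h8 : off ≠ 8) (h9 : off ≠ 9) (h11 : off ≠ 11) {s : Store}
    {o i : ℕ} {l acc : List Bool} (ho : s off = List.replicate o true) (hs9 : s 9 = [])
    (hs10 : s 10 = []) :
    (wireTail off).Within (11 * o + 4 * i + 9) (stream s (encodeUnary i ++ l) acc)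
      (stream s l ((encodeUnary (o + i)).reverse ++ acc)) := by
  have h1 := within_dup (e := off) (x := 8) (t := 9) h8 h9 (by decide)
    (s := stream s (encodeUnary i ++ l) acc) (by simp [stream, hs9])
  have h2 := within_readUnary (x := 11) (d := 8) (f := 10) (by decide) (by decide) (by decide)
    (s := Function.update (stream s (encodeUnary i ++ l) acc) 8
      (stream s (encodeUnary i ++ l) acc off ++ stream s (encodeUnary i ++ l) acc 8))
    (j := i) (l := l) (by simp [stream]) (by simp [stream, hs10])
  refine Within.conv (h1.seq (h2.seq (within_push _ 8 false))) ?_ fun r => ?_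
  · simp [stream, h8, h11, ho]
    omega
  · by_cases hr : r = 8
    · have hrep : List.replicate i true ++ (List.replicate o true ++ acc) =
          List.replicate (o + i) true ++ acc := by
        rw [← List.append_assoc, List.replicate_append_replicate, add_comm]
      simp [hr, stream, h8, h11, ho, encodeUnary, hrep]
    · by_cases hr' : r = 11 <;> simp [hr, hr', stream]

/-- Copy the address of a wire, adding the offset. -/
def relabelWire : Cmd := copyBit (wireTail 6) (wireTail 7)

section

variable {s : Store} {o a n k K : ℕ} {l acc : List Bool}

theorem within_relabelWire (h6 : s 6 = List.replicate o true) (h7 : s 7 = List.replicate a true)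
    (h9 : s 9 = []) (h10 : s 10 = []) (ho : o ≤ K) (ha : a ≤ K) (hn : n ≤ K) (hk : k ≤ K)
    (w : Fin n ⊕ Fin k) :
    relabelWire.Within (15 * K + 12) (stream s (encodeWire w ++ l) acc)
      (stream s l ((shiftWire o a w).reverse ++ acc)) := by
  cases w with
  | inl i =>
    refine Within.conv (within_copyBit (b := false) (within_wireTail (off := 6) (i := i) (by decide)
      (by decide) (by decide) h6 h9 h10)) (by omega) fun r => ?_
    simp [shiftWire]
  | inr i =>
    refine Within.conv (within_copyBit (b := true) (within_wireTail (off := 7) (i := i) (by decide)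
      (by decide) (by decide) h7 h9 h10)) (by omega) fun r => ?_
    simp [shiftWire]

/-- Copy the description of a gate, adding the offsets. -/
def relabelGate : Cmd :=
  copyBit (copyBit relabelWire relabelWire)
    (copyBit (.seq relabelWire relabelWire) (.seq relabelWire (.seq relabelWire relabelWire)))

theorem within_relabelGate (h6 : s 6 = List.replicate o true) (h7 : s 7 = List.replicate a true)
    (h9 : s 9 = []) (h10 : s 10 = []) (ho : o ≤ K) (ha : a ≤ K) (hn : n ≤ K) (hk : k ≤ K)
    (g : Gate (Fin n ⊕ Fin k)) :
    relabelGate.Within (45 * K + 42) (stream s (encodeGate g ++ l) acc)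
      (stream s l ((shiftGate o a g).reverse ++ acc)) := by
  have hw (w : Fin n ⊕ Fin k) (l acc : List Bool) :=
    within_relabelWire (l := l) (acc := acc) h6 h7 h9 h10 ho ha hn hk w
  cases g with
  | H q =>
    refine Within.conv (within_copyBit (b := false) (within_copyBit (b := false) (hw q _ _)))
      (by omega) fun r => ?_
    simp [shiftGate]
  | T q =>
    refine Within.conv (within_copyBit (b := false) (within_copyBit (b := true) (hw q _ _)))
      (by omega) fun r => ?_
    simp [shiftGate]
  | CNOT c t h =>
    have := within_copyBit (c₀ := copyBit relabelWire relabelWire) (b := true)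
      (within_copyBit (c₁ := .seq relabelWire (.seq relabelWire relabelWire)) (b := false)
        ((hw c (encodeWire t ++ l) (false :: true :: acc)).seq (hw t l _)))
    rw [show encodeGate (.CNOT c t h) ++ l =
      true :: false :: (encodeWire c ++ (encodeWire t ++ l)) by simp [encodeGate]]
    refine Within.conv this (by omega) fun r => ?_
    simp [shiftGate]
  | CCNOT c₁ c₂ t h h₁ h₂ =>
    have := within_copyBit (c₀ := copyBit relabelWire relabelWire) (b := true)
      (within_copyBit (c₀ := .seq relabelWire relabelWire) (b := true)
        ((hw c₁ (encodeWire c₂ ++ (encodeWire t ++ l)) (true :: true :: acc)).seq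
          ((hw c₂ (encodeWire t ++ l) _).seq (hw t l _))))
    rw [show encodeGate (.CCNOT c₁ c₂ t h h₁ h₂) ++ l =
      true :: true :: (encodeWire c₁ ++ (encodeWire c₂ ++ (encodeWire t ++ l))) by
        simp [encodeGate]]
    refine Within.conv this (by omega) fun r => ?_
    simp [shiftGate]

/-- Gate codes are self-delimiting and nonempty, so emptiness of the input stack marks the end of
the circuit. -/
theorem within_relabelStream (h6 : s 6 = List.replicate o true)
    (h7 : s 7 = List.replicate a true) (h9 : s 9 = []) (h10 : s 10 = []) (ho : o ≤ K) (ha : a ≤ K)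
    (hn : n ≤ K) (hk : k ≤ K) (C : List (Gate (Fin n ⊕ Fin k))) :
    (Cmd.loop 11 relabelGate).Within (C.length * (45 * K + 43) + 1)
      (stream s (C.flatMap encodeGate) acc)
      (stream s [] ((C.flatMap (shiftGate o a)).reverse ++ acc)) := by
  induction C generalizing acc with
  | nil => exact (within_loop_nil (by simp [stream])).conv (by simp) fun r => by simp
  | cons g C ih =>
    have hne : stream s ((g :: C).flatMap encodeGate) acc 11 ≠ [] := by
      cases g <;> simp [stream, encodeGate]
    refine Within.conv (within_loop_cons hne
      (within_relabelGate (l := C.flatMap encodeGate) h6 h7 h9 h10 ho ha hn hk g) ih) ?_ fun r => ?_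
    · rw [List.length_cons]
      linarith
    · simp

end

/-- The stack with the gates of the circuit for the bit `b`. -/
def gateStack (b : Bool) : ℕ := if b then 15 else 14

/-- The stack with the number of ancilla qubits of the circuit for the bit `b`. -/
def ancillaStack (b : Bool) : ℕ := if b then 5 else 4

/-- The circuits `C b` are on their stacks and the auxiliary stacks are empty. -/
structure Ready (s : Store) {n : ℕ} {a : Bool → ℕ} (C : ∀ b, List (Gate (Fin n ⊕ Fin (a b)))) :
    Prop where
  outputs : s 3 = List.replicate n true
  ancillas : ∀ b, s (ancillaStack b) = List.replicate (a b) true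
  gates : ∀ b, s (gateStack b) = (C b).flatMap encodeGate
  empty : s 9 = [] ∧ s 10 = [] ∧ s 11 = []

/-- The store `s` with the offsets and the reversed list of gates `σ`. -/
def config (s : Store) (σ : ℕ × ℕ × List Bool) : Store :=
  Function.update (Function.update (Function.update s 6 (List.replicate σ.1 true)) 7
    (List.replicate σ.2.1 true)) 8 σ.2.2

/-- The effect of appending a copy of the circuit for the bit `b`. -/
def appendStep {n : ℕ} {a : Bool → ℕ} (C : ∀ b, List (Gate (Fin n ⊕ Fin (a b))))
    (σ : ℕ × ℕ × List Bool) (b : Bool) : ℕ × ℕ × List Bool :=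
  (σ.1 + n, σ.2.1 + a b, ((C b).flatMap (shiftGate σ.1 σ.2.1)).reverse ++ σ.2.2)

/-- Append a copy of the circuit for the bit `b`. -/
def appendCopy (b : Bool) : Cmd :=
  .seq (dup (gateStack b) 11 9) (.seq (.loop 11 relabelGate)
    (.seq (dup 3 6 9) (dup (ancillaStack b) 7 9)))

/-! ### Effect and cost of appending copies of circuits. -/

section

variable {n : ℕ} {a : Bool → ℕ} {C : ∀ b, List (Gate (Fin n ⊕ Fin (a b)))} {s : Store} {L K : ℕ}
  {σ : ℕ × ℕ × List Bool}

/-- `L` bounds the sizes of the circuits. -/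
structure SizeBound (C : ∀ b, List (Gate (Fin n ⊕ Fin (a b)))) (L : ℕ) : Prop where
  outputs : n ≤ L
  ancillas : ∀ b, a b ≤ L
  length : ∀ b, (C b).length ≤ L
  bits : ∀ b, ((C b).flatMap encodeGate).length ≤ L

/-- A bound for the number of steps that append one copy. -/
def copyTime (L K : ℕ) : ℕ := L * (45 * K + 76) + 7

theorem within_appendCopy (hs : Ready s C) (hL : SizeBound C L) (hLK : L ≤ K) (h1 : σ.1 ≤ K)
    (h2 : σ.2.1 ≤ K) (b : Bool) :
    (appendCopy b).Within (copyTime L K) (config s σ) (config s (appendStep C σ b)) := by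
  obtain ⟨h9, h10, h11⟩ := hs.empty
  have hg : gateStack b = 14 ∨ gateStack b = 15 := by cases b <;> simp [gateStack]
  have ha : ancillaStack b = 4 ∨ ancillaStack b = 5 := by cases b <;> simp [ancillaStack]
  have hcg : config s σ (gateStack b) = (C b).flatMap encodeGate := by
    rw [← hs.gates b]
    rcases hg with h | h <;> simp [config, h]
  have hdup := within_dup (e := gateStack b) (x := 11) (t := 9) (by omega) (by omega) (by decide)
    (s := config s σ) (by simp [config, h9])
  have e1 (r : ℕ) : Function.update (config s σ) 11 (config s σ (gateStack b) ++ config s σ 11) r =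
      stream (config s σ) ((C b).flatMap encodeGate) σ.2.2 r := by
    rw [hcg]
    by_cases hr : r = 8
    · simp [hr, stream, config]
    · simp [stream, hr, config, h11]
  have hloop := within_relabelStream (s := config s σ) (o := σ.1) (a := σ.2.1) (K := K)
    (acc := σ.2.2) (by simp [config]) (by simp [config]) (by simp [config, h9])
    (by simp [config, h10]) h1 h2 (hL.outputs.trans hLK) ((hL.ancillas b).trans hLK) (C b)
  set acc := ((C b).flatMap (shiftGate σ.1 σ.2.1)).reverse ++ σ.2.2 with hacc
  have e2 (r : ℕ) : stream (config s σ) [] acc r = config s (σ.1, σ.2.1, acc) r := by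
    by_cases hr : r = 8
    · simp [hr, stream, config]
    · by_cases hr' : r = 11
      · simp [hr', stream, config, h11]
      · simp [hr, hr', stream, config]
  have hO := within_dup (e := 3) (x := 6) (t := 9) (by decide) (by decide) (by decide)
    (s := config s (σ.1, σ.2.1, acc)) (by simp [config, h9])
  have e3 (r : ℕ) : Function.update (config s (σ.1, σ.2.1, acc)) 6
      (config s (σ.1, σ.2.1, acc) 3 ++ config s (σ.1, σ.2.1, acc) 6) r =
        config s (σ.1 + n, σ.2.1, acc) r := by
    by_cases hr : r = 6
    · simp [hr, config, hs.outputs, add_comm σ.1]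
    · by_cases hr' : r = 7
      · simp [hr', config]
      · by_cases hr'' : r = 8 <;> simp [hr, hr', hr'', config]
  have hca : config s (σ.1 + n, σ.2.1, acc) (ancillaStack b) = List.replicate (a b) true := by
    rw [← hs.ancillas b]
    rcases ha with h | h <;> simp [config, h]
  have hA := within_dup (e := ancillaStack b) (x := 7) (t := 9) (by omega) (by omega) (by decide)
    (s := config s (σ.1 + n, σ.2.1, acc)) (by simp [config, h9])
  have e4 (r : ℕ) : Function.update (config s (σ.1 + n, σ.2.1, acc)) 7
      (config s (σ.1 + n, σ.2.1, acc) (ancillaStack b) ++ config s (σ.1 + n, σ.2.1, acc) 7) r =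
        config s (appendStep C σ b) r := by
    rw [hca]
    by_cases hr' : r = 7
    · simp [hr', config, appendStep, add_comm σ.2.1]
    · by_cases hr'' : r = 8 <;> simp [hr', hr'', config, appendStep, hacc]
  refine Within.conv ((hdup.conv le_rfl e1).seq ((hloop.conv le_rfl e2).seq
    ((hO.conv le_rfl e3).seq (hA.conv le_rfl e4)))) ?_ fun r => rfl
  have hG : (C b).length * (45 * K + 43) ≤ L * (45 * K + 43) := Nat.mul_le_mul_right _ (hL.length b)
  have hn := hL.outputs
  have hab := hL.ancillas b
  have hbits := hL.bits b
  have h3 : (config s (σ.1, σ.2.1, acc) 3).length = n := by simp [config, hs.outputs]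
  -- Three duplications cost 11L each, which turns the 43 of the loop into 76; the additive
  -- constants 2 + 1 + 2 + 2 give 7.
  rw [hcg, hca, h3, List.length_replicate, copyTime]
  linarith

theorem Ready.update (hs : Ready s C) {r : ℕ} (hr : r ∈ [0, 1, 2, 12]) (l : List Bool) :
    Ready (Function.update s r l) C := by
  have h (r' : ℕ) (hr' : r' ∉ [0, 1, 2, 12]) : Function.update s r l r' = s r' :=
    Function.update_of_ne (by rintro rfl; exact hr' hr) _ _
  obtain ⟨h9, h10, h11⟩ := hs.empty
  refine ⟨(h _ (by simp)).trans hs.outputs, fun b => (h _ ?_).trans (hs.ancillas b),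
    fun b => (h _ ?_).trans (hs.gates b), (h _ (by simp)).trans h9, (h _ (by simp)).trans h10,
    (h _ (by simp)).trans h11⟩
  · cases b <;> simp [ancillaStack]
  · cases b <;> simp [gateStack]

theorem config_update {r : ℕ} (hr : r ∈ [0, 1, 2, 12]) (l : List Bool) :
    config (Function.update s r l) σ = Function.update (config s σ) r l := by
  simp only [config]
  rw [Function.update_comm (a := r) (b := 6) (by rintro rfl; simp at hr),
    Function.update_comm (a := r) (b := 7) (by rintro rfl; simp at hr),
    Function.update_comm (a := r) (b := 8) (by rintro rfl; simp at hr)]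

/-- Append as many copies of the circuit for the bit `b` as the stack `2` says. -/
def appendCopies (b : Bool) : Cmd :=
  .seq (dup 2 12 9) (.loop 12 (.seq (.pop 12) (appendCopy b)))

/-- A bound for the number of steps that append `m` copies. -/
def copiesTime (m L K : ℕ) : ℕ := m * (copyTime L K + 13) + 3

/-- Every copy raises an offset by at most L, so the hypotheses keep all offsets below K. The cost
per copy is then uniform, and the same inequality is the invariant of the induction. -/
theorem within_appendCopies (hs : Ready s C) (hL : SizeBound C L) (hLK : L ≤ K) {m : ℕ}
    (h1 : σ.1 + m * L ≤ K) (h2 : σ.2.1 + m * L ≤ K) (hm : s 2 = List.replicate m true)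
    (h12 : s 12 = []) (b : Bool) :
    (appendCopies b).Within (copiesTime m L K) (config s σ)
      (config s ((List.replicate m b).foldl (appendStep C) σ)) := by
  have hdup := within_dup (e := 2) (x := 12) (t := 9) (by decide) (by decide) (by decide)
    (s := config s σ) (by simp [config, hs.empty.1])
  have hc2 : config s σ 2 = List.replicate m true := by simp [config, hm]
  have hc12 : config s σ 12 = [] := by simp [config, h12]
  rw [hc2, hc12, List.append_nil, List.length_replicate] at hdup
  have hloop (j : ℕ) : ∀ σ : ℕ × ℕ × List Bool, σ.1 + j * L ≤ K → σ.2.1 + j * L ≤ K →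
      (Cmd.loop 12 (.seq (.pop 12) (appendCopy b))).Within (j * (copyTime L K + 2) + 1)
        (Function.update (config s σ) 12 (List.replicate j true))
        (config s ((List.replicate j b).foldl (appendStep C) σ)) := by
    induction j with
    | zero =>
      intro σ _ _
      refine Within.conv (within_loop_nil (by simp)) (by simp) fun r => ?_
      by_cases hr : r = 12 <;> simp [hr, config, h12]
    | succ j ih =>
      intro σ h1 h2
      rw [Nat.succ_mul] at h1 h2
      have hstep := within_appendCopy (σ := σ)
        (hs.update (r := 12) (by simp) (List.replicate j true)) hL hLK (by omega) (by omega) b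
      rw [config_update (by simp), config_update (by simp)] at hstep
      have hpop := within_pop (Function.update (config s σ) 12 (List.replicate (j + 1) true)) 12
      rw [Function.update_self, Function.update_idem, List.replicate_succ, List.tail_cons,
        ← List.replicate_succ] at hpop
      have h1' := hL.outputs
      have h2' := hL.ancillas b
      refine Within.conv (within_loop_cons (by simp) (hpop.seq hstep)
        (ih (appendStep C σ b) ?_ ?_)) ?_ fun r => ?_
      · simp only [appendStep]
        omega
      · simp only [appendStep]
        omega
      · linarith
      · rw [List.replicate_succ, List.foldl_cons]
  refine Within.conv (hdup.seq (hloop m σ h1 h2)) ?_ fun r => rfl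
  rw [copiesTime]
  linarith

/-- For each bit of the key on stack `1`, append copies of the corresponding circuit. -/
def appendAll : Cmd :=
  .loop 1 (.branch 1 .skip (.seq (.pop 1) (appendCopies false)) (.seq (.pop 1) (appendCopies true)))

theorem appendStep_foldl_le (hL : SizeBound C L) (l : List Bool) (σ : ℕ × ℕ × List Bool) :
    (l.foldl (appendStep C) σ).1 ≤ σ.1 + l.length * L ∧
      (l.foldl (appendStep C) σ).2.1 ≤ σ.2.1 + l.length * L := by
  induction l generalizing σ with
  | nil => simp
  | cons b l ih =>
    have := ih (appendStep C σ b)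
    have h1 := hL.outputs
    have h2 := hL.ancillas b
    rw [List.foldl_cons, List.length_cons, Nat.succ_mul]
    simp only [appendStep] at this ⊢
    omega

theorem within_appendAll (hs : Ready s C) (hL : SizeBound C L) (hLK : L ≤ K) {m : ℕ}
    (hm : s 2 = List.replicate m true) (h12 : s 12 = []) (keys : List Bool) :
    ∀ σ : ℕ × ℕ × List Bool, σ.1 + keys.length * (m * L) ≤ K →
      σ.2.1 + keys.length * (m * L) ≤ K →
    appendAll.Within (keys.length * (copiesTime m L K + 3) + 1)
      (Function.update (config s σ) 1 keys)
      (Function.update (config s ((keys.flatMap (List.replicate m)).foldl (appendStep C) σ)) 1 []) := by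
  induction keys with
  | nil => exact fun σ _ _ => (within_loop_nil (by simp)).conv (by simp) fun r => rfl
  | cons b keys ih =>
    intro σ h1 h2
    rw [List.length_cons, Nat.succ_mul] at h1 h2
    have hpop := within_pop (Function.update (config s σ) 1 (b :: keys)) 1
    rw [Function.update_self, Function.update_idem, List.tail_cons] at hpop
    have hrep := within_appendCopies (σ := σ) (hs.update (r := 1) (by simp) keys) hL hLK (m := m)
      (by omega) (by omega) (by simp [hm]) (by simp [h12]) b
    rw [config_update (by simp), config_update (by simp)] at hrep
    have hbr : (Cmd.branch 1 .skip (.seq (.pop 1) (appendCopies false))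
        (.seq (.pop 1) (appendCopies true))).Within (1 + copiesTime m L K + 1)
        (Function.update (config s σ) 1 (b :: keys))
        (Function.update (config s ((List.replicate m b).foldl (appendStep C) σ)) 1 keys) := by
      refine within_branch (b := b) (l := keys) (by simp) ?_
      cases b <;> exact hpop.seq hrep
    have hle := appendStep_foldl_le hL (List.replicate m b) σ
    rw [List.length_replicate] at hle
    refine Within.conv (within_loop_cons (by simp) hbr (ih _ (by omega) (by omega))) ?_ fun r => ?_
    · rw [List.length_cons]
      linarith
    · rw [List.flatMap_cons, List.foldl_append]

/-- Write the description of the assembled circuit on the stack `0`. -/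
def finish : Cmd :=
  .seq (drain 0 []) (.seq (drain 8 [0]) (.seq (.push 0 false) (.seq (dup 7 0 9)
    (.seq (.push 0 false) (dup 6 0 9)))))

/-- Moving stack 8 onto stack 0 undoes the reversal of the gates. The header goes on afterwards,
last field first, and the final offsets are exactly the total numbers of qubits. -/
theorem within_finish (s : Store) {o a : ℕ} (h6 : s 6 = List.replicate o true)
    (h7 : s 7 = List.replicate a true) (h9 : s 9 = []) :
    ∃ s' : Store, finish.Within (4 * (s 0).length + 5 * (s 8).length + 11 * o + 11 * a + 10) s s' ∧
      s' 0 = encodeUnary o ++ encodeUnary a ++ (s 8).reverse := by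
  have g1 := within_drain (x := 0) (ys := []) (by simp) (by simp) s
  set s₁ : Store := fun r => if r = 0 then [] else if r ∈ [] then (s 0).reverse ++ s r else s r
    with hs₁
  have g2 := within_drain (x := 8) (ys := [0]) (by simp) (by simp) s₁
  set s₂ : Store := fun r => if r = 8 then [] else if r ∈ [0] then (s₁ 8).reverse ++ s₁ r else s₁ r
    with hs₂
  have g3 := within_push s₂ 0 false
  have g4 := within_dup (e := 7) (x := 0) (t := 9) (by decide) (by decide) (by decide)
    (s := Function.update s₂ 0 (false :: s₂ 0)) (by simp [hs₂, hs₁, h9])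
  set s₃ := Function.update s₂ 0 (false :: s₂ 0) with hs₃
  set s₄ := Function.update s₃ 0 (s₃ 7 ++ s₃ 0) with hs₄
  have g5 := within_push s₄ 0 false
  set s₅ := Function.update s₄ 0 (false :: s₄ 0) with hs₅
  have g6 := within_dup (e := 6) (x := 0) (t := 9) (by decide) (by decide) (by decide)
    (s := s₅) (by simp [hs₅, hs₄, hs₃, hs₂, hs₁, h9])
  have h8 : s₁ 8 = s 8 := by simp [hs₁]
  have h7' : s₃ 7 = List.replicate a true := by simp [hs₃, hs₂, hs₁, h7]
  have h6' : s₅ 6 = List.replicate o true := by simp [hs₅, hs₄, hs₃, hs₂, hs₁, h6]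
  refine ⟨_, (g1.seq (g2.seq (g3.seq (g4.seq (g5.seq g6))))).mono ?_, ?_⟩
  · rw [h8, h7', h6']
    simp
    omega
  · simp [hs₅, hs₄, hs₃, hs₂, hs₁, h6, h7, encodeUnary]

end

end Cmd

/-! ### The description of a product of circuits -/

section Description

variable {n : ℕ} {a : Bool → ℕ} (C : ∀ b, List (Gate (Fin n ⊕ Fin (a b))))

/-- Closed form of the program's state. Ancilla offsets are partial sums because the two circuits
may use different numbers of ancillas; output offsets are multiples of n. -/
theorem foldl_appendStep_ofFn (N : ℕ) (β : Fin N → Bool) (o A : ℕ) (acc : List Bool) :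
    (List.ofFn β).foldl (Cmd.appendStep C) (o, A, acc) =
      (o + N * n, A + ∑ s, a (β s), ((List.finRange N).flatMap fun s => (C (β s)).flatMap
        (shiftGate (o + n * s) (A + ∑ i : Fin s, a (β (Fin.castLE s.2.le i))))).reverse ++ acc) := by
  induction N generalizing o A acc with
  | zero => simp
  | succ N ih =>
    rw [List.ofFn_succ, List.foldl_cons, Cmd.appendStep, ih, List.finRange_succ, List.flatMap_cons,
      List.flatMap_map, Fin.sum_univ_succ, List.reverse_append, List.append_assoc]
    refine Prod.ext ?_ (Prod.ext ?_ ?_)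
    · simp only [Nat.succ_mul]
      omega
    · simp only [add_assoc]
    · simp only
      congr 2
      · congr 1
        funext s
        have h1 : o + n + n * (s : ℕ) = o + n * ((s.succ : Fin (N + 1)) : ℕ) := by
          rw [Fin.val_succ, Nat.mul_succ]
          omega
        have h2 : A + a (β 0) + ∑ i : Fin s, a (β (Fin.castLE s.2.le i).succ) =
            A + ∑ i : Fin (s.succ : Fin (N + 1)), a (β (Fin.castLE s.succ.2.le i)) := by
          rw [add_assoc]
          exact congrArg (A + ·) (Fin.sum_univ_succ
            fun i : Fin (s + 1) => a (β (Fin.castLE s.succ.2.le i))).symm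
        rw [h1, h2]

theorem encodeGate_map {n k n' k' : ℕ} {o A : ℕ} (ι : Fin n ⊕ Fin k ↪ Fin n' ⊕ Fin k')
    (h : ∀ w, encodeWire (ι w) = shiftWire o A w) (g : Gate (Fin n ⊕ Fin k)) :
    encodeGate (g.map ι) = shiftGate o A g := by
  cases g <;> simp [Gate.map, encodeGate, shiftGate, h]

/-- The offsets reached by the fold are precisely the wire positions given by eO and
`finSigmaFinEquiv`, so the two descriptions agree bit for bit. -/
theorem encodeCircuit_productCircuit {N n' : ℕ} (β : Fin N → Bool)
    (eO : (Σ _ : Fin N, Fin n) ≃ Fin n') (hO : ∀ s w, (eO ⟨s, w⟩ : ℕ) = n * s + w) (hn : n' = N * n)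
    {σ : ℕ × ℕ × List Bool}
    (hσ : σ = (List.ofFn β).foldl (Cmd.appendStep C) (0, 0, [])) :
    encodeCircuit (productCircuit eO finSigmaFinEquiv (List.finRange N) fun s => C (β s)) =
      encodeUnary σ.1 ++ encodeUnary σ.2.1 ++ σ.2.2.reverse := by
  rw [hσ, foldl_appendStep_ofFn, encodeCircuit, productCircuit, List.flatMap_assoc]
  simp only [zero_add, List.append_nil, List.reverse_reverse, ← hn]
  congr 2
  funext s
  rw [List.flatMap_map]
  congr 1
  funext g
  refine encodeGate_map _ (fun w => ?_) g
  rcases w with w | w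
  · exact congrArg (fun i => false :: encodeUnary i) (hO s w)
  · exact congrArg (fun i => true :: encodeUnary i) 
      (finSigmaFinEquiv_apply (n := fun s => a (β s)) ⟨s, w⟩)

theorem ofFn_flatMap_replicate {lam : ℕ} (k : Fin lam → Bool) (m : ℕ) :
    (List.ofFn k).flatMap (List.replicate m) =
      List.ofFn fun s : Fin (lam * m) => k (finProdFinEquiv.symm s).1 := by
  rw [List.ofFn_mul, List.flatMap_def, List.map_ofFn]
  congr 2
  funext i
  rw [Function.comp_apply, ← List.ofFn_const]
  congr 1
  funext j
  congr 1
  exact (congrArg Prod.fst (finProdFinEquiv.symm_apply_apply (i, j))).symm.trans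
    (congrArg (fun s => (finProdFinEquiv.symm s).1)
      (Fin.ext (by simp [finProdFinEquiv]; ring)))

end Description

/-! ### The programs -/

namespace Cmd

theorem Within.length_le {p : Cmd} {T : ℕ} {s s' : Store} (h : p.Within T s s') (r : ℕ) :
    (s' r).length ≤ (s r).length + T :=
  let ⟨_, hk, hr⟩ := h
  (hr.length_le r).trans (Nat.add_le_add_left hk _)

/-- Write `1^{lam^d}` on stack `2`, where `1^lam` is on stack `0`. -/
def power : ℕ → Cmd
  | 0 => .push 2 true
  | d + 1 => .seq (power d) (.seq (.loop 2 (.seq (.pop 2) (dup 0 11 9))) (drain 11 [2]))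

/-- A bound for the running time of `power`. -/
def powerTime (lam : ℕ) : ℕ → ℕ
  | 0 => 1
  | d + 1 => powerTime lam d + (lam ^ d * (11 * lam + 4) + 5 * lam ^ (d + 1) + 2)

theorem within_power (d : ℕ) {lam : ℕ} {s : Store} (h0 : s 0 = List.replicate lam true)
    (h2 : s 2 = []) (h9 : s 9 = []) (h11 : s 11 = []) :
    (power d).Within (powerTime lam d) s
      (Function.update s 2 (List.replicate (lam ^ d) true)) := by
  -- Multiplication by lam: each one popped from stack 2 puts a copy of stack 0 on stack 11.
  have hloop (j : ℕ) : ∀ s : Store, s 0 = List.replicate lam true → s 9 = [] →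
      s 2 = List.replicate j true →
      (Cmd.loop 2 (.seq (.pop 2) (dup 0 11 9))).Within (j * (11 * lam + 4) + 1) s
        (Function.update (Function.update s 2 []) 11 (List.replicate (j * lam) true ++ s 11)) := by
    induction j with
    | zero =>
      intro s _ _ h2
      refine Within.conv (within_loop_nil h2) (by simp) fun r => ?_
      by_cases h : r = 11
      · simp [h]
      · by_cases h' : r = 2
        · subst h'
          simpa using h2
        · simp [h, h']
    | succ j ih =>
      intro s h0 h9 h2
      have g1 := within_pop s 2
      have g2 := within_dup (e := 0) (x := 11) (t := 9) (by decide) (by decide) (by decide)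
        (s := Function.update s 2 (s 2).tail) (by simp [h9])
      refine Within.conv (within_loop_cons (by simp [h2]) (g1.seq g2)
        (ih _ (by simp [h0]) (by simp [h9]) (by simp [h2]))) ?_ fun r => ?_
      · simp [h0]
        linarith
      · by_cases h : r = 11
        · simp [h, h0, Nat.succ_mul]
          rw [← List.append_assoc, List.replicate_append_replicate]
        · by_cases h' : r = 2 <;> simp [h, h']
  induction d with
  | zero => exact Within.conv (within_push s 2 true) le_rfl fun r => by simp [h2]
  | succ d ih =>
    set s₁ := Function.update s 2 (List.replicate (lam ^ d) true) with hs₁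
    have g1 := hloop (lam ^ d) s₁ (by simp [hs₁, h0]) (by simp [hs₁, h9]) (by simp [hs₁])
    have e1 : s₁ 11 = [] := by simp [hs₁, h11]
    rw [e1, List.append_nil, ← pow_succ] at g1
    have g2 := within_drain (x := 11) (ys := [2]) (by simp) (by simp)
      (Function.update (Function.update s₁ 2 []) 11 (List.replicate (lam ^ (d + 1)) true))
    refine Within.conv (ih.seq (g1.seq g2)) ?_ fun r => ?_
    · simp [powerTime]
      linarith
    · by_cases h : r = 11
      · simp [h, h11]
      · by_cases h' : r = 2 <;> simp [h, h', hs₁]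

/-- Run the program `P` for both values of its input bit on separate stacks. -/
def runBoth (P : Cmd) : Cmd :=
  .seq (dup 0 14 9) (.seq (dup 0 15 9) (.seq (.push 16 false) (.seq (.push 17 true)
    (.seq (P.rename fun r => 14 + 2 * r) (P.rename fun r => 15 + 2 * r)))))

/-- The two runs live on the even and on the odd stacks from 14 upwards. By the frame property they
disturb neither each other nor the stacks below 14. -/
theorem within_runBoth {P : Cmd} {lam T : ℕ} {s : Bool → Store}
    (hP : ∀ b, P.Within T (initStore lam [b]) (s b)) (keys : List Bool) :
    ∃ u : Store, (runBoth P).Within (22 * lam + 2 * T + 6) (initStore lam keys) u ∧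
      (∀ r < 14, u r = initStore lam keys r) ∧ u 14 = s false 0 ∧ u 15 = s true 0 := by
  obtain ⟨k₀, hk₀, hr₀⟩ := hP false
  obtain ⟨k₁, hk₁, hr₁⟩ := hP true
  set s₀ := initStore lam keys with hs₀
  have g1 := within_dup (e := 0) (x := 14) (t := 9) (by decide) (by decide) (by decide) (s := s₀)
    (by simp [hs₀, initStore])
  set s₁ := Function.update s₀ 14 (s₀ 0 ++ s₀ 14) with hs₁
  have g2 := within_dup (e := 0) (x := 15) (t := 9) (by decide) (by decide) (by decide) (s := s₁)
    (by simp [hs₁, hs₀, initStore])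
  set s₂ := Function.update s₁ 15 (s₁ 0 ++ s₁ 15) with hs₂
  have g3 := within_push s₂ 16 false
  set s₃ := Function.update s₂ 16 (false :: s₂ 16) with hs₃
  have g4 := within_push s₃ 17 true
  set s₄ := Function.update s₃ 17 (true :: s₃ 17) with hs₄
  have hlow (r : ℕ) (hr : r < 14) : s₄ r = s₀ r := by
    rw [hs₄, hs₃, hs₂, hs₁, Function.update_of_ne (by omega), Function.update_of_ne (by omega),
      Function.update_of_ne (by omega), Function.update_of_ne (by omega)]
  have hhigh (r : ℕ) (hr : 17 < r) : s₄ r = [] := by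
    rw [hs₄, hs₃, hs₂, hs₁, Function.update_of_ne (by omega), Function.update_of_ne (by omega),
      Function.update_of_ne (by omega), Function.update_of_ne (by omega), hs₀, initStore,
      if_neg (by omega), if_neg (by omega)]
  have heven : s₄ ∘ (fun r => 14 + 2 * r) = initStore lam [false] := by
    funext r
    rcases r with _ | _ | r
    · simp [hs₄, hs₃, hs₂, hs₁, hs₀, initStore]
    · simp [hs₄, hs₃, hs₂, hs₁, hs₀, initStore]
    · rw [Function.comp_apply, hhigh _ (by omega)]
      simp [initStore]
  have hodd : s₄ ∘ (fun r => 15 + 2 * r) = initStore lam [true] := by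
    funext r
    rcases r with _ | _ | r
    · simp [hs₄, hs₃, hs₂, hs₁, hs₀, initStore]
    · simp [hs₄, hs₃, hs₂, hs₁, hs₀, initStore]
    · rw [Function.comp_apply, hhigh _ (by omega)]
      simp [initStore]
  obtain ⟨u₁, hu₁, hu₁e, hu₁o⟩ := hr₀.rename (f := fun r => 14 + 2 * r)
    (fun x y h => by simpa using h) s₄ heven
  have hu₁odd : u₁ ∘ (fun r => 15 + 2 * r) = initStore lam [true] := by
    rw [← hodd]
    funext r
    refine hu₁o _ ?_
    rintro ⟨x, hx⟩
    simp only at hx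
    omega
  obtain ⟨u₂, hu₂, hu₂e, hu₂o⟩ := hr₁.rename (f := fun r => 15 + 2 * r)
    (fun x y h => by simpa using h) u₁ hu₁odd
  refine ⟨u₂, (g1.seq (g2.seq (g3.seq (g4.seq (Within.seq ⟨_, hk₀, hu₁⟩ ⟨_, hk₁, hu₂⟩))))).mono ?_,
    fun r hr => ?_, ?_, congrFun hu₂e 0⟩
  · simp [hs₁, hs₀, initStore]
    omega
  · rw [hu₂o, hu₁o, hlow r hr] <;> rintro ⟨x, hx⟩ <;> simp only at hx <;> omega
  · rw [hu₂o]
    · exact congrFun hu₁e 0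
    · rintro ⟨x, hx⟩
      simp only at hx
      omega

/-- Split the descriptions of two circuits into numbers of qubits and gates. -/
def readHeaders : Cmd :=
  .seq (readUnary 14 3 10) (.seq (readUnary 14 4 10) (.seq (readUnary 15 13 10)
    (readUnary 15 5 10)))

theorem within_readHeaders {n a₀ a₁ : ℕ} {G₀ G₁ : List Bool} {s : Store}
    (h14 : s 14 = encodeUnary n ++ encodeUnary a₀ ++ G₀)
    (h15 : s 15 = encodeUnary n ++ encodeUnary a₁ ++ G₁) (h : ∀ r, 2 ≤ r → r < 14 → s r = []) :
    ∃ u : Store, readHeaders.Within (8 * n + 4 * a₀ + 4 * a₁ + 24) s u ∧ u 0 = s 0 ∧ u 1 = s 1 ∧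
      u 3 = List.replicate n true ∧ u 4 = List.replicate a₀ true ∧ u 5 = List.replicate a₁ true ∧
      u 14 = G₀ ∧ u 15 = G₁ ∧ ∀ r ∈ [2, 6, 7, 8, 9, 10, 11, 12], u r = [] := by
  have g1 := within_readUnary (x := 14) (d := 3) (f := 10) (by decide) (by decide) (by decide)
    (s := s) (by rw [h14, List.append_assoc]) (h 10 (by decide) (by decide))
  set s₁ := Function.update (Function.update s 14 (encodeUnary a₀ ++ G₀)) 3
    (List.replicate n true ++ s 3) with hs₁
  have g2 := within_readUnary (x := 14) (d := 4) (f := 10) (by decide) (by decide) (by decide)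
    (s := s₁) (j := a₀) (l := G₀) (by simp [hs₁])
    (by simp [hs₁, h 10 (by decide) (by decide)])
  set s₂ := Function.update (Function.update s₁ 14 G₀) 4 (List.replicate a₀ true ++ s₁ 4) with hs₂
  -- Both circuits have n output qubits, so the second occurrence of n is dumped on stack 13, which
  -- is not used afterwards.
  have g3 := within_readUnary (x := 15) (d := 13) (f := 10) (by decide) (by decide) (by decide)
    (s := s₂) (j := n) (l := encodeUnary a₁ ++ G₁) (by simp [hs₂, hs₁, h15])
    (by simp [hs₂, hs₁, h 10 (by decide) (by decide)])
  set s₃ := Function.update (Function.update s₂ 15 (encodeUnary a₁ ++ G₁)) 13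
    (List.replicate n true ++ s₂ 13) with hs₃
  have g4 := within_readUnary (x := 15) (d := 5) (f := 10) (by decide) (by decide) (by decide)
    (s := s₃) (j := a₁) (l := G₁) (by simp [hs₃])
    (by simp [hs₃, hs₂, hs₁, h 10 (by decide) (by decide)])
  refine ⟨_, (g1.seq (g2.seq (g3.seq g4))).mono (by omega), ?_⟩
  refine ⟨?_, ?_, ?_, ?_, ?_, ?_, ?_, fun r hr => ?_⟩
  iterate 7 simp [hs₃, hs₂, hs₁, h 3 (by decide) (by decide), h 4 (by decide) (by decide),
    h 5 (by decide) (by decide)]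
  have hr' : s r = [] := by
    fin_cases hr <;> exact h _ (by decide) (by decide)
  fin_cases hr <;> simpa [hs₃, hs₂, hs₁] using hr'

/-- The program that describes a circuit preparing `lam^d` copies of the state generated by `P`
for each bit of the input. -/
def stateGen (P : Cmd) (d : ℕ) : Cmd :=
  .seq (runBoth P) (.seq readHeaders (.seq (power d) (.seq appendAll finish)))

/-- A bound for the running time of `appendAll` in `stateGen`. -/
def appendTime (d lam T : ℕ) : ℕ :=
  lam * (copiesTime (lam ^ d) (lam + T) (lam * (lam ^ d * (lam + T)) + (lam + T)) + 3) + 1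

/-- A bound for the running time of `stateGen`. -/
def stateGenTime (d lam T : ℕ) : ℕ :=
  (22 * lam + 2 * T + 6) + ((16 * (lam + T) + 24) + (powerTime lam d + (appendTime d lam T +
    (4 * lam + 5 * appendTime d lam T + 22 * (lam * (lam ^ d * (lam + T))) + 10))))

theorem length_le_of_encode {n k : ℕ} (C : List (Gate (Fin n ⊕ Fin k))) :
    C.length ≤ (C.flatMap encodeGate).length := by
  induction C with
  | nil => simp
  | cons g C ih =>
    have : 1 ≤ (encodeGate g).length := by cases g <;> simp [encodeGate]
    rw [List.length_cons, List.flatMap_cons, List.length_append]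
    omega

theorem within_stateGen {P : Cmd} {lam T n : ℕ} {a : Bool → ℕ} {s : Bool → Store}
    (C : ∀ b, List (Gate (Fin n ⊕ Fin (a b))))
    (hP : ∀ b, P.Within T (initStore lam [b]) (s b)) (hs : ∀ b, s b 0 = encodeCircuit (C b))
    (d : ℕ) {keys : List Bool} (hkeys : keys.length = lam) :
    ∃ u : Store, (stateGen P d).Within (stateGenTime d lam T) (initStore lam keys) u ∧
      u 0 = encodeUnary ((keys.flatMap (List.replicate (lam ^ d))).foldl (appendStep C) (0, 0, [])).1
        ++ encodeUnary
          ((keys.flatMap (List.replicate (lam ^ d))).foldl (appendStep C) (0, 0, [])).2.1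
        ++ ((keys.flatMap (List.replicate (lam ^ d))).foldl (appendStep C) (0, 0, [])).2.2.reverse := by
  set σ := (keys.flatMap (List.replicate (lam ^ d))).foldl (appendStep C) (0, 0, []) with hσ
  -- A description written within T steps on a stack that initially holds lam bits has length at
  -- most lam + T.
  set L := lam + T with hLdef
  have hlen (b : Bool) : (encodeCircuit (C b)).length ≤ L := by
    have := (hP b).length_le 0
    rw [hs b] at this
    simpa [initStore] using this
  have hL : SizeBound C L := by
    have h (b : Bool) : n + a b + ((C b).flatMap encodeGate).length ≤ L := by
      have := hlen b
      simp only [encodeCircuit, encodeUnary, List.length_append, List.length_replicate,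
        List.length_singleton] at this
      omega
    refine ⟨?_, fun b => ?_, fun b => ?_, fun b => ?_⟩
    · have := h true
      omega
    · have := h b
      omega
    · have := h b
      have := length_le_of_encode (C b)
      omega
    · have := h b
      omega
  obtain ⟨u, hu, hlow, h14, h15⟩ := within_runBoth hP keys
  rw [hs, encodeCircuit] at h14 h15
  obtain ⟨v, hread, hv0, hv1, hv3, hv4, hv5, hv14, hv15, hv⟩ := within_readHeaders h14 h15
    fun r h2 h14 => by
      rw [hlow r h14, initStore, if_neg (by omega), if_neg (by omega)]
  rw [hlow 0 (by decide)] at hv0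
  rw [hlow 1 (by decide)] at hv1
  have hv0 : v 0 = List.replicate lam true := hv0
  have hv1 : v 1 = keys := hv1
  have hpow := within_power d hv0 (hv 2 (by simp)) (hv 9 (by simp)) (hv 11 (by simp))
  set w := Function.update v 2 (List.replicate (lam ^ d) true) with hw
  have hready : Ready w C := by
    refine ⟨by simp [hw, hv3], fun b => ?_, fun b => ?_, by simp [hw, hv 9], by simp [hw, hv 10],
      by simp [hw, hv 11]⟩
    · cases b <;> simp [hw, ancillaStack, hv4, hv5]
    · cases b <;> simp [hw, gateStack, hv14, hv15]
  -- The first summand of K bounds the offsets after all lam * lam^d copies; the second ensures L ≤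
  -- K.
  have happ := within_appendAll hready hL (K := lam * (lam ^ d * L) + L) (Nat.le_add_left _ _)
    (m := lam ^ d) (by simp [hw]) (by simp [hw, hv 12]) keys (0, 0, []) (by simp [hkeys])
    (by simp [hkeys])
  have hw' (r : ℕ) : w r = Function.update (config w (0, 0, [])) 1 keys r := by
    by_cases h1 : r = 1
    · simp [h1, hw, hv1]
    · by_cases h6 : r = 6
      · simp [h6, config, hw, hv 6]
      · by_cases h7 : r = 7
        · simp [h7, config, hw, hv 7]
        · by_cases h8 : r = 8
          · simp [h8, config, hw, hv 8]
          · simp [h1, h6, h7, h8, config]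
  rw [← hσ] at happ
  set x := Function.update (config w σ) 1 [] with hx
  obtain ⟨y, hy, hy0⟩ := within_finish x (o := σ.1) (a := σ.2.1) (by simp [hx, config])
    (by simp [hx, config]) (by simp [hx, config, hw, hv 9])
  have hx8 : x 8 = σ.2.2 := by simp [hx, config]
  have hx0 : x 0 = List.replicate lam true := by simp [hx, config, hw, hv0]
  rw [hx8] at hy0
  refine ⟨y, ?_, hy0⟩
  have happ' := happ
  rw [← (funext hw' : w = Function.update (config w (0, 0, [])) 1 keys), hkeys] at happ'
  -- The amount of gate code left to move is bounded by the time that was available to write it.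
  have hacc := happ'.length_le 8
  have hw8 : (w 8).length = 0 := by simp [hw, hv 8]
  have hσle := appendStep_foldl_le hL (keys.flatMap (List.replicate (lam ^ d))) (0, 0, [])
  rw [← hσ] at hσle
  have hlen' : (keys.flatMap (List.replicate (lam ^ d))).length * L = lam * (lam ^ d * L) := by
    simp [List.length_flatMap, hkeys, mul_assoc]
  rw [hlen'] at hσle
  refine (hu.seq (Within.seq hread (hpow.seq (happ'.seq hy)))).mono ?_
  rw [hx8, hw8] at hacc
  rw [hx8, hx0, List.length_replicate]
  have h1 := hL.outputs
  have h2 := hL.ancillas true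
  have h3 := hL.ancillas false
  simp only [stateGenTime, ← hLdef, appendTime]
  simp only [zero_add] at hσle hacc
  omega

/-- The circuit that applies a Hadamard gate to a single qubit. -/
def plusCircuit (b : Bool) : List (Gate (Fin 1 ⊕ Fin 0)) :=
  if b then [] else [.H (Sum.inl 0)]

/-- The program that describes the circuit applying a Hadamard gate to each of `lam` qubits. -/
def keyGen : Cmd :=
  .seq (.push 14 false) (.seq (.push 14 false) (.seq (.push 14 false)
    (.seq (.push 14 false) (.seq (.push 3 true) (.seq (dup 0 2 9)
      (.seq (appendCopies false) finish))))))

/-- A bound for the running time of `keyGen`. -/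
def keyGenTime (lam : ℕ) : ℕ :=
  5 + ((11 * lam + 2) + (copiesTime lam 4 (lam * 4 + 4) +
    (4 * lam + 5 * copiesTime lam 4 (lam * 4 + 4) + 88 * lam + 10)))

theorem within_keyGen (lam : ℕ) :
    ∃ u : Store, keyGen.Within (keyGenTime lam) (initStore lam []) u ∧
      u 0 = encodeUnary ((List.replicate lam false).foldl (appendStep plusCircuit) (0, 0, [])).1
        ++ encodeUnary ((List.replicate lam false).foldl (appendStep plusCircuit) (0, 0, [])).2.1
        ++ ((List.replicate lam false).foldl (appendStep plusCircuit) (0, 0, [])).2.2.reverse := by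
  set σ := (List.replicate lam false).foldl (appendStep plusCircuit) (0, 0, []) with hσ
  set s := initStore lam [] with hs
  have h0 : s 0 = List.replicate lam true := rfl
  have hs' (r : ℕ) (hr : r ≠ 0) : s r = [] := by
    rw [hs, initStore, if_neg hr]
    split_ifs <;> rfl
  have hL : SizeBound plusCircuit 4 :=
    ⟨by decide, fun b => by simp, fun b => by cases b <;> simp [plusCircuit],
      fun b => by cases b <;> simp [plusCircuit, encodeGate, encodeWire, encodeUnary]⟩
  -- The four zeros describe a Hadamard gate on output qubit 0: opcode 00, register bit 0, and index
  -- 0 in unary. Each circuit has one output qubit.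
  set u := Function.update (Function.update s 14 [false, false, false, false]) 3 [true] with hu
  have g6 := within_dup (e := 0) (x := 2) (t := 9) (by decide) (by decide) (by decide)
    (s := u) (by simp [hu, hs'])
  have hu0 : u 0 = List.replicate lam true := by simp [hu, h0]
  have hu2 : u 2 = [] := by simp [hu, hs']
  rw [hu0, hu2, List.append_nil] at g6
  set w := Function.update u 2 (List.replicate lam true) with hw
  have hready : Ready w plusCircuit := by
    refine ⟨by simp [hw, hu], fun b => ?_, fun b => ?_, by simp [hw, hu, hs'], by simp [hw, hu, hs'],
      by simp [hw, hu, hs']⟩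
    · cases b <;> simp [hw, hu, hs', ancillaStack]
    · cases b <;> simp [hw, hu, hs', gateStack, plusCircuit, encodeGate, encodeWire, encodeUnary]
  have happ := within_appendCopies hready hL (K := lam * 4 + 4) (σ := (0, 0, []))
    (Nat.le_add_left _ _) (m := lam) (by simp) (by simp) (by simp [hw]) (by simp [hw, hu, hs']) false
  rw [← hσ] at happ
  obtain ⟨y, hy, hy0⟩ := within_finish (config w σ) (o := σ.1) (a := σ.2.1) (by simp [config])
    (by simp [config]) (by simp [config, hw, hu, hs'])
  have hx8 : config w σ 8 = σ.2.2 := by simp [config]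
  have hx0 : config w σ 0 = List.replicate lam true := by simp [config, hw, hu0]
  have hacc := happ.length_le 8
  have hw8 : config w (0, 0, []) 8 = [] := by simp [config]
  rw [hx8, hw8, List.length_nil, zero_add] at hacc
  rw [hx8] at hy0
  have hσle := appendStep_foldl_le hL (List.replicate lam false) (0, 0, [])
  rw [← hσ, List.length_replicate] at hσle
  have hw' (r : ℕ) : w r = config w (0, 0, []) r := by
    by_cases h6 : r = 6
    · simp [h6, config, hw, hu, hs']
    · by_cases h7 : r = 7
      · simp [h7, config, hw, hu, hs']
      · by_cases h8 : r = 8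
        · simp [h8, config, hw, hu, hs']
        · simp [h6, h7, h8, config]
  refine ⟨y, ?_, hy0⟩
  have g14 (l : List Bool) : (Cmd.push 14 false).Within 1 (Function.update s 14 l)
      (Function.update s 14 (false :: l)) :=
    (within_push _ 14 false).conv le_rfl fun r => by simp
  have hs14 : Function.update s 14 [] = s := by
    rw [← hs' 14 (by decide), Function.update_eq_self]
  have g0 := g14 []
  rw [hs14] at g0
  have g5 : (Cmd.push 3 true).Within 1 (Function.update s 14 [false, false, false, false]) u :=
    (within_push _ 3 true).conv le_rfl fun r => by simp [hu, hs']
  have hwc : w = config w (0, 0, []) := funext hw'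
  rw [← hwc] at happ
  refine (g0.seq ((g14 _).seq ((g14 _).seq ((g14 _).seq (g5.seq (g6.seq
    (happ.seq hy))))))).mono ?_
  rw [hx8, hx0, List.length_replicate]
  simp only [zero_add] at hσle
  simp only [keyGenTime]
  omega

end Cmd

/-! ### Polynomial bounds -/

namespace PolyBounded

variable {f g : ℕ → ℕ}

theorem const (c : ℕ) : PolyBounded fun _ => c := ⟨Polynomial.C c, fun _ => by simp⟩

theorem id : PolyBounded fun lam => lam := ⟨Polynomial.X, fun _ => by simp⟩

theorem add (hf : PolyBounded f) (hg : PolyBounded g) : PolyBounded fun lam => f lam + g lam :=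
  let ⟨p, hp⟩ := hf
  let ⟨q, hq⟩ := hg
  ⟨p + q, fun lam => by simpa using Nat.add_le_add (hp lam) (hq lam)⟩

theorem mul (hf : PolyBounded f) (hg : PolyBounded g) : PolyBounded fun lam => f lam * g lam :=
  let ⟨p, hp⟩ := hf
  let ⟨q, hq⟩ := hg
  ⟨p * q, fun lam => by simpa using Nat.mul_le_mul (hp lam) (hq lam)⟩

theorem pow (hf : PolyBounded f) (d : ℕ) : PolyBounded fun lam => f lam ^ d :=
  let ⟨p, hp⟩ := hf
  ⟨p ^ d, fun lam => by simpa using Nat.pow_le_pow_left (hp lam) d⟩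

theorem mono (hg : PolyBounded g) (h : ∀ lam, f lam ≤ g lam) : PolyBounded f :=
  let ⟨q, hq⟩ := hg
  ⟨q, fun lam => (h lam).trans (hq lam)⟩

end PolyBounded

namespace Cmd

theorem polyBounded_copiesTime {m L K : ℕ → ℕ} (hm : PolyBounded m) (hL : PolyBounded L)
    (hK : PolyBounded K) : PolyBounded fun lam => copiesTime (m lam) (L lam) (K lam) :=
  (hm.mul (((hL.mul (((PolyBounded.const 45).mul hK).add (.const 76))).add (.const 7)).add
    (.const 13))).add (.const 3)

theorem polyBounded_keyGenTime : PolyBounded keyGenTime := by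
  have hc : PolyBounded fun lam => copiesTime lam 4 (lam * 4 + 4) :=
    polyBounded_copiesTime .id (.const 4) ((PolyBounded.id.mul (.const 4)).add (.const 4))
  exact (PolyBounded.const 5).add ((((PolyBounded.const 11).mul .id).add (.const 2)).add
    (hc.add (((((PolyBounded.const 4).mul .id).add ((PolyBounded.const 5).mul hc)).add
      ((PolyBounded.const 88).mul .id)).add (.const 10))))

theorem polyBounded_powerTime (d : ℕ) : PolyBounded fun lam => powerTime lam d := by
  induction d with
  | zero => exact .const 1
  | succ d ih =>
    exact ih.add ((((PolyBounded.id.pow d).mul (((PolyBounded.const 11).mul .id).add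
      (.const 4))).add ((PolyBounded.const 5).mul (PolyBounded.id.pow (d + 1)))).add (.const 2))

theorem polyBounded_stateGenTime (d : ℕ) {T : ℕ → ℕ} (hT : PolyBounded T) :
    PolyBounded fun lam => stateGenTime d lam (T lam) := by
  have hL : PolyBounded fun lam => lam + T lam := PolyBounded.id.add hT
  have hK : PolyBounded fun lam => lam * (lam ^ d * (lam + T lam)) :=
    PolyBounded.id.mul ((PolyBounded.id.pow d).mul hL)
  have ha : PolyBounded fun lam => appendTime d lam (T lam) :=
    (PolyBounded.id.mul ((polyBounded_copiesTime (PolyBounded.id.pow d) hL (hK.add hL)).add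
      (.const 3))).add (.const 1)
  exact ((((PolyBounded.const 22).mul .id).add ((PolyBounded.const 2).mul hT)).add (.const 6)).add
    ((((PolyBounded.const 16).mul hL).add (.const 24)).add ((polyBounded_powerTime d).add
      (ha.add (((((PolyBounded.const 4).mul .id).add ((PolyBounded.const 5).mul ha)).add
        ((PolyBounded.const 22).mul hK)).add (.const 10)))))

end Cmd

/-! ### The state generator built from a pair of states -/

section Wires

/-- The qubit `w` of the register `s`, as a qubit of the concatenation of the registers. -/
def concatWires (N n : ℕ) : (Σ _ : Fin N, Fin n) ≃ Fin (N * n) :=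
  (Equiv.sigmaEquivProd _ _).trans finProdFinEquiv

theorem concatWires_val (N n : ℕ) (s : Fin N) (w : Fin n) :
    (concatWires N n ⟨s, w⟩ : ℕ) = n * s + w := by
  simp [concatWires, finProdFinEquiv, add_comm]

/-- The concatenation of registers consisting of one qubit. -/
def singleWires (N : ℕ) : (Σ _ : Fin N, Fin 1) ≃ Fin N :=
  (Equiv.sigmaEquivProd _ _).trans (Equiv.prodUnique _ _)

theorem singleWires_val (N : ℕ) (s : Fin N) (w : Fin 1) :
    (singleWires N ⟨s, w⟩ : ℕ) = 1 * s + w := by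
  simp [singleWires]

/-- The concatenation of `l` blocks of `m` registers of `n` qubits. -/
def blockWires (l m n : ℕ) : (Σ _ : Fin l, Σ _ : Fin m, Fin n) ≃ Fin (l * m * n) :=
  ((Equiv.sigmaCongrRight fun _ => Equiv.sigmaEquivProd _ _).trans
    ((Equiv.sigmaEquivProd _ _).trans ((Equiv.prodAssoc _ _ _).symm.trans
      (Equiv.prodCongr finProdFinEquiv (Equiv.refl _))))).trans finProdFinEquiv

/-- The registers of several copies of a concatenation of registers. -/
def copyWires (t N n : ℕ) : (Σ _ : Fin t × Fin N, Fin n) ≃ Fin t × Fin (N * n) :=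
  ((Equiv.sigmaEquivProd _ _).trans (Equiv.prodAssoc _ _ _)).trans
    (Equiv.prodCongr (Equiv.refl _) finProdFinEquiv)

/-- The flat list of slots suits generation and the hybrids; grouping it into blocks, one per key
bit, suits verification. -/
theorem slotState_eq_relabel_blockWires {l m n : ℕ} (ξ : Bool → Op (Fin n)) (k : Fin l → Bool) :
    slotState (concatWires (l * m) n) ξ (fun s => k (finProdFinEquiv.symm s).1) =
      relabel (blockWires l m n) (tensorFam fun i => tensorFam fun _ : Fin m => ξ (k i)) := by
  ext x y
  simp only [slotState, relabel_apply, tensorFam]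
  rw [← Fintype.prod_prod_type', ← finProdFinEquiv.prod_comp]
  refine Finset.prod_congr rfl fun p _ => ?_
  rw [Equiv.symm_apply_apply]
  rfl

/-- Copies of a product state again form a product over slots, so the hybrid argument handles t
copies directly with t * N slots. -/
theorem tensorPow_slotState {t N n : ℕ} (ξ : Bool → Op (Fin n)) (b : Fin N → Bool) :
    tensorPow (slotState (concatWires N n) ξ b) t =
      slotState (copyWires t N n) ξ fun p => b p.2 := by
  ext x y
  simp only [tensorPow, slotState, relabel_apply, tensorFam]
  rw [← Fintype.prod_prod_type']
  rfl

end Wires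

/-- Keys are obtained by measurement, so the diagonal entries are all that is needed. -/
theorem preparedState_plusCircuit (x : Fin 1 → Bool) :
    preparedState (Cmd.plusCircuit false) x x = 1 / 2 := by
  have h (z : Fin 0 → Bool) :
      onQubit hadamardMatrix (Sum.inl 0 : Fin 1 ⊕ Fin 0) (Sum.elim x z) (fun _ => false) =
        ((1 / Real.sqrt 2 : ℝ) : ℂ) := by
    rw [onQubit, if_pos]
    · simp [hadamardMatrix]
    · rintro (w | w) hw
      · exact absurd (congrArg Sum.inl (Subsingleton.elim w 0)) hw
      · exact w.elim0
  have hs : ((1 / Real.sqrt 2 : ℝ) : ℂ) * ((1 / Real.sqrt 2 : ℝ) : ℂ) = 1 / 2 := by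
    rw [← Complex.ofReal_mul, div_mul_div_comm, Real.mul_self_sqrt (by norm_num)]
    norm_num
  have h' (z : Fin 0 → Bool) : runCircuit (Cmd.plusCircuit false) (zeroState (Fin 1 ⊕ Fin 0))
      (Sum.elim x z) (Sum.elim x z) = 1 / 2 := by
    have hC : circuitOp (Cmd.plusCircuit false) = onQubit hadamardMatrix (Sum.inl 0) := one_mul _
    rw [runCircuit, hC, zeroState]
    rw [Matrix.mul_apply, Finset.sum_eq_single fun _ => false]
    · rw [Matrix.mul_single_apply_same, mul_one, Matrix.conjTranspose_apply, h, ← hs]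
      simp
    · intro y _ hy
      rw [Matrix.mul_single_apply_of_ne _ _ _ _ _ hy, zero_mul]
    · simp
  simp only [preparedState, partialTrace]
  rw [Finset.sum_congr rfl fun z _ => h' z]
  simp

/-- The state generator with uniform keys whose states consist, for each bit `b` of the key, of
`lam ^ d` copies of `ξ lam b`; the verification applies the tests `E` to all blocks. -/
def blockGenerator (S : StatePair) (d : ℕ)
    (E : ∀ lam, Op (Σ _ : Fin (lam ^ d), Fin (S.n lam))) : StateGenerator where
  keyState lam := relabel (singleWires lam)
    (tensorFam fun _ => preparedState (Cmd.plusCircuit false))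
  n lam := lam * lam ^ d * S.n lam
  φ lam k := slotState (concatWires (lam * lam ^ d) (S.n lam)) (S.ξ lam)
    fun s => k (finProdFinEquiv.symm s).1
  ver lam k := relabel (blockWires lam (lam ^ d) (S.n lam))
    (tensorFam fun i => effect (E lam) (k i))

/-! ### Key distribution and uniform generation for the block construction. -/

section Generator

variable {S : StatePair} {d : ℕ} {E : ∀ lam, Op (Σ _ : Fin (lam ^ d), Fin (S.n lam))}

theorem keyProb_blockGenerator (lam : ℕ) (k : Key lam) :
    (blockGenerator S d E).keyProb lam k = (1 / 2) ^ lam := by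
  have h : (blockGenerator S d E).keyState lam k k = (((1 / 2) ^ lam : ℝ) : ℂ) := by
    simp only [blockGenerator, relabel_apply, tensorFam, preparedState_plusCircuit]
    simp
  rw [StateGenerator.keyProb, h, Complex.ofReal_re]

theorem sum_keyProb (lam : ℕ) (c : ℝ) :
    ∑ k : Key lam, (blockGenerator S d E).keyProb lam k * c = c := by
  simp [keyProb_blockGenerator]

theorem keyGen_qpt_blockGenerator :
    UniformQPTGenerates (fun _ => Unit) (fun _ _ => []) (fun lam => lam)
      (fun lam _ => (blockGenerator S d E).keyState lam) := by
  obtain ⟨p, hp⟩ := Cmd.polyBounded_keyGenTime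
  refine ⟨Cmd.keyGen, p, fun lam _ => ?_⟩
  obtain ⟨u, ⟨k, hk, hr⟩, hu⟩ := Cmd.within_keyGen lam
  refine ⟨_, productCircuit (singleWires lam) finSigmaFinEquiv (List.finRange lam)
    fun _ => Cmd.plusCircuit false, k, u, hr, hk.trans (hp lam), ?_, ?_⟩
  · rw [hu]
    exact (encodeCircuit_productCircuit Cmd.plusCircuit (fun _ => false) (singleWires lam)
      (singleWires_val lam) (mul_one lam).symm (by rw [List.ofFn_const])).symm
  · exact (preparedState_productCircuit (singleWires lam) finSigmaFinEquiv (List.nodup_finRange lam)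
      (List.mem_finRange) _).symm

theorem stateGen_qpt_blockGenerator
    (hS : UniformQPTGenerates (fun _ => Bool) (fun _ b => [b]) S.n S.ξ) :
    UniformQPTGenerates Key (fun _ k => List.ofFn k) (blockGenerator S d E).n
      (blockGenerator S d E).φ := by
  obtain ⟨P, p, hP⟩ := hS
  choose a C T s hr hT hs hξ using hP
  obtain ⟨q, hq⟩ := Cmd.polyBounded_stateGenTime d (T := fun lam => p.eval lam) ⟨p, fun _ => le_rfl⟩
  refine ⟨Cmd.stateGen P d, q, fun lam k => ?_⟩
  obtain ⟨u, ⟨K, hK, hu⟩, hu0⟩ := Cmd.within_stateGen (C lam)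
    (fun b => ⟨T lam b, hT lam b, hr lam b⟩) (hs lam) d (keys := List.ofFn k) List.length_ofFn
  refine ⟨_, productCircuit (concatWires (lam * lam ^ d) (S.n lam)) finSigmaFinEquiv
    (List.finRange (lam * lam ^ d)) fun s => C lam (k (finProdFinEquiv.symm s).1), K, u, hu,
    hK.trans (hq lam), ?_, ?_⟩
  · rw [hu0]
    exact (encodeCircuit_productCircuit (C lam) (fun s => k (finProdFinEquiv.symm s).1) _
      (concatWires_val _ _) rfl (by rw [ofFn_flatMap_replicate])).symm
  · refine Eq.trans ?_ (preparedState_productCircuit (concatWires (lam * lam ^ d) (S.n lam))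
      finSigmaFinEquiv (List.nodup_finRange _) List.mem_finRange _).symm
    change slotState _ _ _ = _
    simp only [slotState, hξ]

theorem acceptProb_blockGenerator {lam : ℕ} (hE : IsPOVMElement (E lam))
    (hξ : ∀ b, IsState (S.ξ lam b)) (k' k : Key lam) :
    acceptProb ((blockGenerator S d E).ver lam k') ((blockGenerator S d E).φ lam k) =
      ∏ i, acceptProb (effect (E lam) (k' i)) (tensorFam fun _ => S.ξ lam (k i)) := by
  change acceptProb (relabel (blockWires lam (lam ^ d) (S.n lam))
    (tensorFam fun i => effect (E lam) (k' i))) (slotState (concatWires _ _) _ _) = _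
  rw [slotState_eq_relabel_blockWires, acceptProb_relabel,
    acceptProb_tensorFam (fun i => (hE.effect _).1) fun i => (isState_tensorFam fun _ => hξ _).1]

/-- The adversary at the security parameter `lam`. -/
def Adversary.device {In : ℕ → Type} [∀ lam, Fintype (In lam)] [∀ lam, DecidableEq (In lam)]
    {m : ℕ → ℕ} (A : Adversary In m) (lam : ℕ) : Device (In lam) (m lam) :=
  ⟨A.adviceQubits lam, A.advice lam, A.advice_isState lam, A.circuit lam, A.out lam⟩

/-! ### Completeness and soundness of blockwise verification. -/

section Bounds

variable {ε : ℝ} {lam : ℕ} (hE : IsPOVMElement (E lam)) (hξ : ∀ b, IsState (S.ξ lam b))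
  (hε : ∀ b, acceptProb (effect (E lam) (!b)) (tensorFam fun _ => S.ξ lam b) ≤ ε)

include hE hξ

theorem acceptProb_effect_mem_Icc (b c : Bool) :
    acceptProb (effect (E lam) b) (tensorFam fun _ => S.ξ lam c) ∈ Set.Icc (0 : ℝ) 1 :=
  ⟨acceptProb_nonneg (hE.effect b) (isState_tensorFam fun _ => hξ c),
    acceptProb_le_one (hE.effect b) (isState_tensorFam fun _ => hξ c)⟩

theorem acceptProb_blockGenerator_mem_Icc (k' k : Key lam) :
    acceptProb ((blockGenerator S d E).ver lam k') ((blockGenerator S d E).φ lam k) ∈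
      Set.Icc (0 : ℝ) 1 := by
  rw [acceptProb_blockGenerator hE hξ]
  exact ⟨Finset.prod_nonneg fun i _ => (acceptProb_effect_mem_Icc hE hξ _ _).1,
    Finset.prod_le_one (fun i _ => (acceptProb_effect_mem_Icc hE hξ _ _).1)
      fun i _ => (acceptProb_effect_mem_Icc hE hξ _ _).2⟩

theorem correctProb_blockGenerator_le_one : (blockGenerator S d E).correctProb lam ≤ 1 := by
  rw [← sum_keyProb (S := S) (d := d) (E := E) lam 1]
  refine Finset.sum_le_sum fun k _ => mul_le_mul_of_nonneg_left
    (acceptProb_blockGenerator_mem_Icc hE hξ k k).2 ?_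
  rw [keyProb_blockGenerator]
  positivity

include hε

theorem le_correctProb_blockGenerator : 1 - lam * ε ≤ (blockGenerator S d E).correctProb lam := by
  rw [← sum_keyProb (S := S) (d := d) (E := E) lam (1 - lam * ε)]
  refine Finset.sum_le_sum fun k _ => mul_le_mul_of_nonneg_left ?_ ?_
  · rw [acceptProb_blockGenerator hE hξ]
    have hp (b : Bool) :
        1 - ε ≤ acceptProb (effect (E lam) b) (tensorFam fun _ => S.ξ lam b) := by
      have h1 : effect (E lam) (!b) = 1 - effect (E lam) b := by cases b <;> simp [effect]
      have := hε b
      rw [h1, acceptProb_one_sub (isState_tensorFam fun _ => hξ b)] at this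
      linarith
    have h0 : 0 ≤ ε := (acceptProb_effect_mem_Icc hE hξ _ _).1.trans (hε true)
    -- Bernoulli's inequality needs ε at most 1. For larger ε the claimed bound is negative, except
    -- at lam = 0 where the empty product is 1.
    rcases le_or_gt ε 1 with h1 | h1
    · calc 1 - lam * ε ≤ (1 - ε) ^ lam := by
            have := one_add_mul_le_pow (a := -ε) (by linarith) lam
            simpa [sub_eq_add_neg] using this
        _ = ∏ _i : Fin lam, (1 - ε) := by simp
        _ ≤ _ := Finset.prod_le_prod (fun _ _ => by linarith) fun i _ => hp (k i)
    · rcases Nat.eq_zero_or_pos lam with rfl | hlam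
      · simp
      · have h2 : (1 : ℝ) ≤ lam := by exact_mod_cast hlam
        refine le_trans ?_ (Finset.prod_nonneg fun i _ => (acceptProb_effect_mem_Icc hE hξ _ _).1)
        nlinarith
  · rw [keyProb_blockGenerator]
    positivity

/-- A wrong key differs from k at some i, and acceptance then requires the test of block i to err.
The other factors are at most 1. -/
theorem acceptProb_blockGenerator_le (k' k : Key lam) :
    acceptProb ((blockGenerator S d E).ver lam k') ((blockGenerator S d E).φ lam k) ≤
      (if k' = k then 1 else 0) + ε := by
  have h0 : 0 ≤ ε := (acceptProb_effect_mem_Icc hE hξ _ _).1.trans (hε true)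
  split_ifs with h
  · have := (acceptProb_blockGenerator_mem_Icc (d := d) hE hξ k' k).2
    linarith
  · obtain ⟨i, hi⟩ := Function.ne_iff.1 h
    have hi' : k' i = !k i := by cases h1 : k' i <;> cases h2 : k i <;> simp_all
    rw [acceptProb_blockGenerator hE hξ, ← Finset.mul_prod_erase _ _ (Finset.mem_univ i), zero_add]
    refine le_trans (mul_le_of_le_one_right (acceptProb_effect_mem_Icc hE hξ _ _).1
      (Finset.prod_le_one (fun j _ => (acceptProb_effect_mem_Icc hE hξ _ _).1)
        fun j _ => (acceptProb_effect_mem_Icc hE hξ _ _).2)) ?_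
    rw [hi']
    exact hε (k i)

end Bounds

theorem successProb_blockGenerator_le_one {lam : ℕ} (hE : IsPOVMElement (E lam))
    (hξ : ∀ b, IsState (S.ξ lam b)) {t : ℕ → ℕ} (A : (blockGenerator S d E).Inverter t) :
    (blockGenerator S d E).successProb A lam ≤ 1 := by
  rw [← sum_keyProb (S := S) (d := d) (E := E) lam 1]
  refine Finset.sum_le_sum fun k _ => mul_le_mul_of_nonneg_left ?_ ?_
  · have hρ : IsState (tensorPow ((blockGenerator S d E).φ lam k) (t lam)) := by
      simp only [blockGenerator]
      rw [tensorPow_slotState]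
      exact isState_slotState _ hξ _
    rw [← (A.device lam).sum_prob hρ]
    exact Finset.sum_le_sum fun k' _ => mul_le_of_le_one_right
      ((A.device lam).prob_nonneg hρ k') (acceptProb_blockGenerator_mem_Icc hE hξ k' k).2
  · rw [keyProb_blockGenerator]
    positivity

/-- At a single security parameter, inverting the generator is reduced to distinguishing. -/
theorem exists_device_successProb_le {lam : ℕ} (hE : IsPOVMElement (E lam))
    (hξ : ∀ b, IsState (S.ξ lam b)) {ε : ℝ}
    (hε : ∀ b, acceptProb (effect (E lam) (!b)) (tensorFam fun _ => S.ξ lam b) ≤ ε)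
    {t : ℕ → ℕ} (A : (blockGenerator S d E).Inverter t) :
    ∃ B : Device (Fin (S.n lam)) 1,
      B.qubits ≤ t lam * (lam * lam ^ d) * S.n lam + A.adviceQubits lam + 1 ∧
      B.circuit.length ≤ (A.circuit lam).length + lam ∧
      (blockGenerator S d E).successProb A lam ≤
        2 * ((t lam * (lam * lam ^ d) : ℕ) : ℝ) *
          |B.prob (S.ξ lam false) (fun _ => true) - B.prob (S.ξ lam true) fun _ => true| +
        (1 / 2) ^ lam + ε := by
  obtain ⟨B, hB₁, hB₂, hB⟩ := exists_distinguisher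
    (copyWires (t lam) (lam * lam ^ d) (S.n lam)) hξ (A.device lam)
  rw [Fintype.card_prod, Fintype.card_fin, Fintype.card_fin] at hB₁ hB
  refine ⟨B, hB₁, hB₂, ?_⟩
  set adv := 2 * ((t lam * (lam * lam ^ d) : ℕ) : ℝ) *
    |B.prob (S.ξ lam false) (fun _ => true) - B.prob (S.ξ lam true) fun _ => true|
  set slots : Key lam → Fin (t lam) × Fin (lam * lam ^ d) → Bool :=
    fun k p => k (finProdFinEquiv.symm p.2).1
  set ρ : (Fin (t lam) × Fin (lam * lam ^ d) → Bool) → Op (Fin (t lam) × Fin _) :=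
    slotState (copyWires (t lam) (lam * lam ^ d) (S.n lam)) (S.ξ lam) with hρ
  have hρs (b) : IsState (ρ b) := isState_slotState _ hξ b
  have hφ (k : Key lam) : tensorPow ((blockGenerator S d E).φ lam k) (t lam) = ρ (slots k) :=
    tensorPow_slotState _ _
  have hinner (k : Key lam) : ∑ k' : Key lam,
      A.prob lam (tensorPow ((blockGenerator S d E).φ lam k) (t lam)) k' *
        acceptProb ((blockGenerator S d E).ver lam k') ((blockGenerator S d E).φ lam k) ≤
      (A.device lam).prob (ρ fun _ => false) k + adv + ε := by
    rw [hφ]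
    calc _ ≤ ∑ k' : Key lam, (A.device lam).prob (ρ (slots k)) k' *
            ((if k' = k then 1 else 0) + ε) :=
          Finset.sum_le_sum fun k' _ => mul_le_mul_of_nonneg_left
            (acceptProb_blockGenerator_le hE hξ hε k' k) ((A.device lam).prob_nonneg (hρs _) k')
      _ = (A.device lam).prob (ρ (slots k)) k + ε := by
          simp only [mul_add, Finset.sum_add_distrib, ← Finset.sum_mul,
            (A.device lam).sum_prob (hρs _), one_mul]
          simp
      -- The hybrid bound is used with the true key as the target string; the distinguisher was
      -- chosen before k.
      _ ≤ _ := add_le_add_left (hB (slots k) (fun _ => false) k) ε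
  have hkey (k : Key lam) : 0 ≤ (blockGenerator S d E).keyProb lam k := by
    rw [keyProb_blockGenerator]
    positivity
  calc (blockGenerator S d E).successProb A lam
      ≤ ∑ k : Key lam, (blockGenerator S d E).keyProb lam k *
          ((A.device lam).prob (ρ fun _ => false) k + adv + ε) :=
        Finset.sum_le_sum fun k _ => mul_le_mul_of_nonneg_left (hinner k) (hkey k)
    -- The reference state carries no information on k, so its hit probabilities sum to 1 over all
    -- keys, leaving 2^{-lam}.
    _ = (1 / 2) ^ lam * ∑ k : Key lam, (A.device lam).prob (ρ fun _ => false) k +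
          ∑ k : Key lam, (blockGenerator S d E).keyProb lam k * (adv + ε) := by
        rw [Finset.mul_sum, ← Finset.sum_add_distrib]
        refine Finset.sum_congr rfl fun k _ => ?_
        rw [keyProb_blockGenerator]
        ring
    _ = _ := by
        rw [sum_keyProb]
        have hsum : ∑ k : Key lam, (A.device lam).prob (ρ fun _ => false) k = 1 :=
          (A.device lam).sum_prob (hρs _)
        rw [hsum]
        ring

end Generator

/-! ### Asymptotics -/

theorem traceDist_le_one {W : Type} [Fintype W] [DecidableEq W] {ρ σ : Op W} (hρ : IsState ρ)
    (hσ : IsState σ) : traceDist ρ σ ≤ 1 := by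
  obtain ⟨M, hM, h⟩ := exists_helstrom hρ hσ
  have h1 := acceptProb_le_one hM hρ
  have h2 := acceptProb_nonneg hM hσ
  linarith

/-- The power is at most exp(-lam^(2c+2) δ²/4), hence at most exp(-lam²/4). From lam = 4 on this is
at most exp(-lam), and exp(-1) ≤ 1/2. -/
theorem one_sub_pow_le_half_pow {δ : ℝ} {c lam : ℕ} (hlam : 4 ≤ lam) (h : 1 / (lam : ℝ) ^ c ≤ δ)
    (hδ : δ ≤ 1) : (1 - δ ^ 2 / 4) ^ lam ^ (2 * c + 2) ≤ (1 / 2 : ℝ) ^ lam := by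
  have hl : (0 : ℝ) < lam := by exact_mod_cast (by omega : 0 < lam)
  have h0 : 0 ≤ δ := le_trans (by positivity) h
  have h4 : (4 : ℝ) ≤ lam := by exact_mod_cast hlam
  have hexp : 1 - δ ^ 2 / 4 ≤ Real.exp (-(δ ^ 2 / 4)) := Real.one_sub_le_exp_neg _
  have hbase : 0 ≤ 1 - δ ^ 2 / 4 := by nlinarith
  have hpow : (lam : ℝ) ≤ (lam : ℝ) ^ (2 * c + 2) * (δ ^ 2 / 4) := by
    have h1 : 1 ≤ δ * (lam : ℝ) ^ c := by
      rwa [div_le_iff₀ (by positivity)] at h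
    have h2 : 1 ≤ (δ * (lam : ℝ) ^ c) ^ 2 := one_le_pow₀ h1
    have h3 : (lam : ℝ) ^ (2 * c + 2) * (δ ^ 2 / 4) =
        (δ * (lam : ℝ) ^ c) ^ 2 * ((lam : ℝ) * (lam / 4)) := by ring
    rw [h3]
    have h5 : (lam : ℝ) ≤ lam * (lam / 4) := by nlinarith
    nlinarith
  have hhalf : Real.exp (-1) ≤ 1 / 2 := by
    rw [Real.exp_neg, one_div]
    refine inv_anti₀ two_pos ?_
    have := Real.add_one_le_exp 1
    linarith
  calc (1 - δ ^ 2 / 4) ^ lam ^ (2 * c + 2)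
      ≤ Real.exp (-(δ ^ 2 / 4)) ^ lam ^ (2 * c + 2) := pow_le_pow_left₀ hbase hexp _
    _ = Real.exp (-((lam : ℝ) ^ (2 * c + 2) * (δ ^ 2 / 4))) := by
        rw [← Real.exp_nat_mul]
        congr 1
        push_cast
        ring
    _ ≤ Real.exp (lam * (-1)) := Real.exp_le_exp.2 (by linarith)
    _ = Real.exp (-1) ^ lam := Real.exp_nat_mul _ _
    _ ≤ _ := pow_le_pow_left₀ (Real.exp_pos _).le hhalf _

theorem negligible_half_pow : Negligible fun lam => (1 / 2 : ℝ) ^ lam := fun c =>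
  tendsto_pow_const_mul_const_pow_of_lt_one c (by norm_num) (by norm_num)

theorem UniformQPTGenerates.polyBounded {n : ℕ → ℕ} {ρ : ∀ lam, Bool → Op (Fin (n lam))}
    (h : UniformQPTGenerates (fun _ => Bool) (fun _ b => [b]) n ρ) : PolyBounded n := by
  obtain ⟨P, p, hP⟩ := h
  refine (PolyBounded.id.add ⟨p, fun _ => le_rfl⟩).mono fun lam => ?_
  obtain ⟨a, C, k, s, hr, hk, hs, -⟩ := hP lam true
  have := hr.length_le 0
  rw [hs] at this
  simp [initStore, encodeCircuit, encodeUnary] at this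
  omega

theorem exists_ivowsg (S : StatePair) (hS : S.IsEFI) :
    ∃ G : StateGenerator, G.IsIVOWSG ∧
      ∃ C : ℝ, ∀ t : ℕ → ℕ, PolyBounded t → ∃ q : Polynomial ℕ,
        ∀ A : G.Inverter t, ∃ B : S.Distinguisher, ∀ lam : ℕ,
          G.successProb A lam ≤ ((q.eval lam : ℕ) : ℝ) * S.advantage B lam +
            C * (1 / 2 : ℝ) ^ lam := by
  obtain ⟨c, hc⟩ := hS.far
  have hξ (lam b) : IsState (S.ξ lam b) := by
    obtain ⟨P, p, hP⟩ := hS.generatable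
    obtain ⟨a, C, k, s, -, -, -, h⟩ := hP lam b
    exact h ▸ isState_preparedState C
  choose E hE hEε using fun lam => exists_amplified_test (hξ lam) (lam ^ (2 * c + 2))
  set ε : ℕ → ℝ := fun lam =>
    (1 - traceDist (S.ξ lam false) (S.ξ lam true) ^ 2 / 4) ^ lam ^ (2 * c + 2) with hεdef
  obtain ⟨l₀, hl₀⟩ : ∃ l₀, ∀ lam ≥ l₀, ε lam ≤ (1 / 2) ^ lam := by
    refine Filter.eventually_atTop.1 ?_
    filter_upwards [hc, Filter.eventually_ge_atTop 4] with lam h h4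
    exact one_sub_pow_le_half_pow h4 h (traceDist_le_one (hξ lam _) (hξ lam _))
  set G := blockGenerator S (2 * c + 2) E with hG
  have hred : ∃ C : ℝ, ∀ t : ℕ → ℕ, PolyBounded t → ∃ q : Polynomial ℕ,
      ∀ A : G.Inverter t, ∃ B : S.Distinguisher, ∀ lam : ℕ,
        G.successProb A lam ≤ ((q.eval lam : ℕ) : ℝ) * S.advantage B lam +
          C * (1 / 2 : ℝ) ^ lam := by
    -- From l₀ on, blind guessing and the test error each cost at most 2^{-lam}. Below l₀ the
    -- trivial bound 1 is absorbed by 2^{l₀} 2^{-lam}.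
    refine ⟨2 + 2 ^ l₀, fun t ht => ?_⟩
    obtain ⟨q, hq⟩ := (PolyBounded.const 2).mul
      (ht.mul (PolyBounded.id.mul (PolyBounded.id.pow (2 * c + 2))))
    refine ⟨q, fun A => ?_⟩
    -- The distinguisher is picked separately for every lam, which non-uniformity permits; only its
    -- size must be controlled uniformly.
    choose B hB₁ hB₂ hB using fun lam =>
      exists_device_successProb_le (hE lam) (hξ lam) (hEε lam) A
    refine ⟨{ adviceQubits := fun lam => (B lam).qubits
              advice := fun lam => (B lam).advice
              advice_isState := fun lam => (B lam).isState
              circuit := fun lam => (B lam).circuit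
              out := fun lam => (B lam).out
              adviceQubits_poly := ?_
              circuit_poly := ?_ }, fun lam => ?_⟩
    · exact ((((ht.mul (PolyBounded.id.mul (PolyBounded.id.pow (2 * c + 2)))).mul
        hS.generatable.polyBounded).add A.adviceQubits_poly).add (.const 1)).mono hB₁
    · exact (A.circuit_poly.add .id).mono hB₂
    · change _ ≤ _ * |(B lam).prob (S.ξ lam false) (fun _ => true) -
        (B lam).prob (S.ξ lam true) fun _ => true| + _
      set adv := |(B lam).prob (S.ξ lam false) (fun _ => true) -
        (B lam).prob (S.ξ lam true) fun _ => true|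
      have hadv : 0 ≤ adv := abs_nonneg _
      have hpow : (0 : ℝ) < (1 / 2) ^ lam := by positivity
      rcases le_or_gt l₀ lam with h | h
      · have h1 : 2 * ((t lam * (lam * lam ^ (2 * c + 2)) : ℕ) : ℝ) * adv ≤
            ((q.eval lam : ℕ) : ℝ) * adv := by
          refine mul_le_mul_of_nonneg_right ?_ hadv
          exact_mod_cast hq lam
        have h2 : (0 : ℝ) ≤ 2 ^ l₀ * (1 / 2) ^ lam := by positivity
        have := hB lam
        have := hl₀ lam h
        linarith
      · have h1 : (1 : ℝ) ≤ 2 ^ l₀ * (1 / 2) ^ lam := by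
          rw [one_div, inv_pow, ← div_eq_mul_inv, one_le_div (by positivity)]
          exact pow_le_pow_right₀ one_le_two h.le
        have h2 : (0 : ℝ) ≤ ((q.eval lam : ℕ) : ℝ) * adv := by positivity
        have := successProb_blockGenerator_le_one (hE lam) (hξ lam) A
        linarith
  refine ⟨G, ⟨keyGen_qpt_blockGenerator, stateGen_qpt_blockGenerator hS.generatable, ?_, ?_, ?_⟩,
    hred⟩
  · exact fun lam k => isPOVMElement_relabel _ (isPOVMElement_tensorFam fun i => (hE lam).effect _)
  -- The correctness error itself serves as the negligible function; it lies between 0 and lam *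
  -- 2^{-lam} from l₀ on.
  · refine ⟨fun lam => 1 - G.correctProb lam, ?_, fun lam => by linarith⟩
    have hdec : Negligible fun lam => (lam : ℝ) * (1 / 2) ^ lam := negligible_half_pow.param_mul
    refine hdec.trans_eventually_abs_le ?_
    filter_upwards [Filter.eventually_ge_atTop l₀] with lam h
    have h1 := correctProb_blockGenerator_le_one (d := 2 * c + 2) (hE lam) (hξ lam)
    have h2 := le_correctProb_blockGenerator (hE lam) (hξ lam) (hEε lam)
    have h3 := mul_le_mul_of_nonneg_left (hl₀ lam h) (Nat.cast_nonneg (α := ℝ) lam)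
    simp only [Function.comp_apply]
    rw [abs_of_nonneg (by linarith), abs_of_nonneg (by positivity)]
    linarith
  · intro t ht A
    obtain ⟨C, hC⟩ := hred
    obtain ⟨q, hq⟩ := hC t ht
    obtain ⟨B, hB⟩ := hq A
    obtain ⟨ν, hν, hν'⟩ := hS.indistinguishable B
    refine ⟨fun lam => ((q.eval lam : ℕ) : ℝ) * ν lam + C * (1 / 2) ^ lam, ?_, fun lam => ?_⟩
    · refine Asymptotics.SuperpolynomialDecay.add ?_ (negligible_half_pow.const_mul C)
      refine (hν.polynomial_mul (q.map (Nat.castRingHom ℝ))).congr fun lam => ?_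
      simp
    · have := mul_le_mul_of_nonneg_left (hν' lam) (Nat.cast_nonneg (α := ℝ) (q.eval lam))
      linarith [hB lam]

end QCrypto

end

/-- If EFI pairs exist, then IV-OWSGs exist. The second conjunct bounds the security loss: up to
the factor `q`, which is a polynomial independent of the adversary, and a term of the order
`2^{-lam}` of blind guessing, an adversary against the generator is no more successful than some
non-uniform QPT distinguisher is against the EFI pair. -/
theorem mainTheorem2 (S : QCrypto.StatePair) (hS : S.IsEFI) :
    ∃ G : QCrypto.StateGenerator, G.IsIVOWSG ∧
      ∃ C : ℝ, ∀ t : ℕ → ℕ, QCrypto.PolyBounded t → ∃ q : Polynomial ℕ,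
        ∀ A : G.Inverter t, ∃ B : S.Distinguisher, ∀ lam : ℕ,
          G.successProb A lam ≤ ((q.eval lam : ℕ) : ℝ) * S.advantage B lam + C * (1 / 2 : ℝ) ^ lam :=
  QCrypto.exists_ivowsg S hS
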